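/- Let $d\ge 1$ and $\mathbb T^d=\mathbb R^d/\mathbb Z^d$. A generating function is a $C^2$ map $S:\mathbb R^d\times\mathbb R^d\to\mathbb R$ such that $S(x+r,y+r)=S(x,y)$ for all $r\in\mathbb Z^d$ and $x,y\in\mathbb R^d$, and such that for some $A>0$ one has $\sum_{i,j}\frac{\partial^2 S}{\partial x_i\partial y_j}(x,y)\,\xi_i\xi_j\le -A\|\xi\|^2$ for all $x,y,\xi\in\mathbb R^d$. A twist map is a bijection $F$ of $T^*\mathbb T^d=\mathbb T^d\times(\mathbb R^d)^*$ which is induced by the map $\Phi$ of $T^*\mathbb R^d=\mathbb R^d\times(\mathbb R^d)^*$ defined implicitly from some generating function $S$ by $$\Phi(x,p)=(x',p')\iff p=-\partial_1S(x,x')\ \text{ and }\ p'=\partial_2S(x,x').$$ Let $\pi:T^*\mathbb T^d\to\mathbb T^d$ be the canonical projection and $V(\omega)=\ker D\pi(\omega)$ the vertical space at $\omega\in T^*\mathbb T^d$. The map $F$ is without conjugate points if $V(F^n(\omega))\cap DF^n(\omega)\cdot V(\omega)=\{0\}$ for every $\omega\in T^*\mathbb T^d$ and every integer $n\neq0$.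 Theorem 1. Let $F$ be a twist map of $T^*\mathbb T^d$ without conjugate points, and let $\overline F:T^*\mathbb R^d\to T^*\mathbb R^d$ be a (continuous) lift of $F$. Then for every integer $N\ge1$, every $r\in\mathbb Z^d$ and every $x\in\mathbb R^d$, there is a unique $p\in(\mathbb R^d)^*$ such that $\overline F^{N}(x,p)=(x+r,p)$. Moreover, this describes all periodic points of $F$: for every $N\ge1$ and every $(x,p)\in T^*\mathbb R^d$ with projection $\omega\in T^*\mathbb T^d$, one has $F^N(\omega)=\omega$ if and only if there is a (necessarily unique) $r\in\mathbb Z^d$ with $\overline F^{N}(x,p)=(x+r,p)$. -/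

import Mathlib

open scoped Topology

noncomputable section

namespace TwistMap

/-- Euclidean space `ℝ^d`. -/
abbrev E (d : ℕ) : Type := EuclideanSpace ℝ (Fin d)

/-- The cotangent space `T*ℝ^d = ℝ^d × (ℝ^d)*`. -/
abbrev Cot (d : ℕ) : Type := E d × StrongDual ℝ (E d)

/-- The cotangent bundle `T*𝕋^d = 𝕋^d × (ℝ^d)*` of the torus `𝕋^d = (ℝ/ℤ)^d`. -/
abbrev CotTorus (d : ℕ) : Type := UnitAddTorus (Fin d) × StrongDual ℝ (E d)

/-- An integer vector seen as a vector of `ℝ^d`. -/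
def intVec {d : ℕ} (r : Fin d → ℤ) : E d := WithLp.toLp 2 (fun i => (r i : ℝ))

/-- The covering map `T*ℝ^d → T*𝕋^d`. -/
def proj {d : ℕ} (z : Cot d) : CotTorus d := (fun i => ((z.1 i : ℝ) : UnitAddCircle), z.2)

/-- A map of `T*ℝ^d` is a lift of a map of `T*𝕋^d`. -/
structure IsLift {d : ℕ} (Fbar : Cot d → Cot d) (F : CotTorus d → CotTorus d) : Prop where
  continuous : Continuous Fbar
  semiconj : ∀ z, proj (Fbar z) = F (proj z)

/-- A `C²`, diagonally `ℤ^d`-periodic function `S(x, y)` with the uniform twist condition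
`∑ ∂²S/∂x_i∂y_j (x, y) ξ_i ξ_j ≤ -A ‖ξ‖²`; the left-hand side is the second derivative of `S`
at `(x, y)` evaluated on `(ξ, 0)` and `(0, ξ)`. -/
structure IsGeneratingFunction {d : ℕ} (S : E d × E d → ℝ) : Prop where
  contDiff : ContDiff ℝ 2 S
  periodic : ∀ (r : Fin d → ℤ) (x y : E d), S (x + intVec r, y + intVec r) = S (x, y)
  twist : ∃ A : ℝ, 0 < A ∧ ∀ x y ξ : E d,
    fderiv ℝ (fderiv ℝ S) (x, y) (ξ, 0) (0, ξ) ≤ -A * ‖ξ‖ ^ 2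

/-- The partial differential `∂₁S(x, y)` with respect to the first variable. -/
def d₁ {d : ℕ} (S : E d × E d → ℝ) (x y : E d) : StrongDual ℝ (E d) :=
  fderiv ℝ (fun u => S (u, y)) x

/-- The partial differential `∂₂S(x, y)` with respect to the second variable. -/
def d₂ {d : ℕ} (S : E d × E d → ℝ) (x y : E d) : StrongDual ℝ (E d) :=
  fderiv ℝ (fun u => S (x, u)) y

/-- `Fbar` is the map implicitly defined by `S`:
`Fbar (x, p) = (x', p')` iff `p = -∂₁S(x, x')` and `p' = ∂₂S(x, x')`. -/
def IsGeneratedBy {d : ℕ} (Fbar : Cot d → Cot d) (S : E d × E d → ℝ) : Prop :=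
  ∀ (x : E d) (p : StrongDual ℝ (E d)) (x' : E d) (p' : StrongDual ℝ (E d)),
    Fbar (x, p) = (x', p') ↔ p = -d₁ S x x' ∧ p' = d₂ S x x'

/-- A twist map of `T*𝕋^d`: the map induced on the quotient by a map of `T*ℝ^d` that is
implicitly defined by a generating function. -/
def IsTwistMap {d : ℕ} (F : Equiv.Perm (CotTorus d)) : Prop :=
  ∃ S : E d × E d → ℝ, IsGeneratingFunction S ∧
    ∃ Φ : Cot d → Cot d, IsGeneratedBy Φ S ∧ ∀ z, proj (Φ z) = F (proj z)

/-- `L` is the differential of the map `G` of `T*𝕋^d` at the point `proj z`, all tangent spaces of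
`T*𝕋^d` being identified with `ℝ^d × (ℝ^d)*` through the covering map: it is the Fréchet
derivative at `z` of a local lift of `G`. -/
def HasTorusDerivAt {d : ℕ} (G : CotTorus d → CotTorus d) (L : Cot d →L[ℝ] Cot d)
    (z : Cot d) : Prop :=
  ∃ g : Cot d → Cot d, (∀ᶠ w in 𝓝 z, proj (g w) = G (proj w)) ∧ HasFDerivAt g L z

/-- The vertical space, i.e. the kernel of the differential of `(x, p) ↦ x`
(the same subspace of `ℝ^d × (ℝ^d)*` at every point). -/
def vertical (d : ℕ) : Submodule ℝ (Cot d) :=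
  LinearMap.ker (ContinuousLinearMap.fst ℝ (E d) (StrongDual ℝ (E d))).toLinearMap

/-- `F` is without conjugate points: at every point of `T*𝕋^d` and for every integer `n ≠ 0`,
the differential of `F^n` maps the vertical space to a subspace transverse to the vertical
space. -/
def WithoutConjugatePoints {d : ℕ} (F : Equiv.Perm (CotTorus d)) : Prop :=
  ∀ (z : Cot d) (n : ℤ), n ≠ 0 → ∃ L : Cot d →L[ℝ] Cot d,
    HasTorusDerivAt (⇑(F ^ n)) L z ∧ vertical d ⊓ (vertical d).map L.toLinearMap = ⊥

end TwistMap

end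

noncomputable section

namespace TwistMap

set_option maxSynthPendingDepth 3

/-! A continuous lift of a twist map is itself generated by some `S`, so its orbit segments are the
critical points of the discrete action `∑ S (s i, s (i + 1))` with fixed end points. A kernel vector
of the Hessian at such a point is a Jacobi field vanishing at both ends, which the absence of
conjugate points forbids. The critical paths starting at `x` are parametrized by the initial
momentum, hence by a connected space; their Hessians are nondegenerate throughout and semidefinite
at a minimizer, so all are positive definite (`hessian_fixedAction_pos_def`). A coercive function
with only such critical points has just one, by a mountain pass argument
(`eq_of_fderiv_eq_zero_of_pos_def_hessian`). Hence every orbit segment minimizes the action, and the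
initial position and the final position determine the momentum; this gives uniqueness.

For existence, let `h x` be the minimal action of paths of `N` steps from `x` to `x + r`. It is
periodic and upper semicontinuous, so it has a maximum `x₀`, where the first-order condition says
that initial and final momenta agree. The segment then repeats to an infinite orbit, all of whose
segments minimize. Comparing many periods with as many periods of another sequence closing up to
`r`, at a bounded cost for changing the ends, yields `h x₀ ≤ h x` for every `x`
(`fixedAction_le_of_momentum_closes`). So `h` is constant, every `x` is a maximum, and the momentum
closes everywhere. -/

theorem isPreconnected_iInter_of_directed {X ι : Type*} [TopologicalSpace X] [T2Space X]
    [Nonempty ι] (K : ι → Set X) (hdir : Directed (· ⊇ ·) K) (hK : ∀ i, IsCompact (K i))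
    (hconn : ∀ i, IsPreconnected (K i)) : IsPreconnected (⋂ i, K i) := by
  have hcl : IsClosed (⋂ i, K i) := isClosed_iInter fun i => (hK i).isClosed
  have hcpt : IsCompact (⋂ i, K i) :=
    (hK (Classical.arbitrary ι)).of_isClosed_subset hcl (Set.iInter_subset _ _)
  rw [isPreconnected_closed_iff]
  intro t t' ht ht' hsub hne hne'
  by_contra hemp
  rw [Set.not_nonempty_iff_eq_empty] at hemp
  have hdisj : Disjoint ((⋂ i, K i) ∩ t) ((⋂ i, K i) ∩ t') := by
    rw [Set.disjoint_iff]
    rintro z ⟨⟨hz, hzt⟩, -, hzt'⟩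
    exact hemp.subset ⟨hz, hzt, hzt'⟩
  obtain ⟨U, V, hU, hV, hUt, hVt, hUV⟩ :=
    SeparatedNhds.of_isCompact_isCompact (hcpt.inter_right ht) (hcpt.inter_right ht') hdisj
  -- By compactness a single `K i` already lies in `U ∪ V`, and its connectedness contradicts the
  -- separation.
  obtain ⟨i, hi⟩ := exists_subset_nhds_of_isCompact' hdir hK (fun i => (hK i).isClosed)
    (U := U ∪ V) (fun z hz => by
      refine (hU.union hV).mem_nhds ?_
      rcases hsub hz with h | h
      · exact Or.inl (hUt ⟨hz, h⟩)
      · exact Or.inr (hVt ⟨hz, h⟩))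
  obtain ⟨z, hz, hzt⟩ := hne
  obtain ⟨w, hw, hwt⟩ := hne'
  obtain ⟨q, -, hqU, hqV⟩ := hconn i U V hU hV hi
    ⟨z, Set.mem_iInter.1 hz i, hUt ⟨hz, hzt⟩⟩ ⟨w, Set.mem_iInter.1 hw i, hVt ⟨hw, hwt⟩⟩
  exact Set.disjoint_iff.1 hUV ⟨hqU, hqV⟩

/-- The least level at which two points are joined by a compact connected subset of a sublevel
set is attained. -/
theorem exists_isCompact_isPreconnected_min_level {X : Type*} [TopologicalSpace X] [T2Space X]
    {f : X → ℝ} (hf : Continuous f) (hcpt : ∀ c, IsCompact {z | f z ≤ c}) {a b : X}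
    {K₀ : Set X} (hK₀ : IsCompact K₀) (hK₀' : IsPreconnected K₀) (ha : a ∈ K₀) (hb : b ∈ K₀) :
    ∃ (c : ℝ) (K : Set X), IsCompact K ∧ IsPreconnected K ∧ a ∈ K ∧ b ∈ K ∧ (∀ z ∈ K, f z ≤ c) ∧
      ∀ K' : Set X, IsCompact K' → IsPreconnected K' → a ∈ K' → b ∈ K' → ∃ z ∈ K', c ≤ f z := by
  let C : Set ℝ := {c | ∃ K' : Set X, IsCompact K' ∧ IsPreconnected K' ∧ a ∈ K' ∧ b ∈ K' ∧
    ∀ z ∈ K', f z ≤ c}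
  have hCne : C.Nonempty := by
    obtain ⟨z, -, hz⟩ := hK₀.exists_isMaxOn ⟨a, ha⟩ hf.continuousOn
    exact ⟨f z, K₀, hK₀, hK₀', ha, hb, fun w hw => hz hw⟩
  have hCbdd : BddBelow C := ⟨f a, by rintro c ⟨K', -, -, haK, -, h⟩; exact h a haK⟩
  -- Above the infimum, the component of `a` also contains `b`. These continua decrease with the
  -- level, and their intersection joins `a` to `b` at the infimum itself.
  let D : Set.Ioi (sInf C) → Set X := fun c => closure (connectedComponentIn {z | f z ≤ c} a)
  have hmem : ∀ c : Set.Ioi (sInf C), a ∈ {z | f z ≤ c} ∧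
      b ∈ connectedComponentIn {z | f z ≤ c} a := by
    intro c
    obtain ⟨e, ⟨K', -, hconn, haK, hbK, h⟩, hec⟩ := (csInf_lt_iff hCbdd hCne).1 c.2
    have hsub : K' ⊆ {z | f z ≤ c} := fun z hz => (h z hz).trans hec.le
    exact ⟨hsub haK, hconn.subset_connectedComponentIn haK hsub hbK⟩
  have hDsub : ∀ c, D c ⊆ {z | f z ≤ c} := fun c =>
    closure_minimal (connectedComponentIn_subset _ _) (hcpt c).isClosed
  have hDcpt : ∀ c, IsCompact (D c) := fun c =>
    (hcpt c).of_isClosed_subset isClosed_closure (hDsub c)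
  have hmono : ∀ c c' : Set.Ioi (sInf C), c ≤ c' → D c ⊆ D c' := fun c c' h =>
    closure_mono (connectedComponentIn_mono _ fun z (hz : f z ≤ c) => hz.trans h)
  have : Nonempty (Set.Ioi (sInf C)) := ⟨⟨sInf C + 1, by simp⟩⟩
  have hdir : Directed (· ⊇ ·) D := fun c c' =>
    ⟨min c c', hmono _ _ (min_le_left _ _), hmono _ _ (min_le_right _ _)⟩
  refine ⟨sInf C, ⋂ c, D c, ?_, ?_, ?_, ?_, ?_, ?_⟩
  · exact (hDcpt (Classical.arbitrary _)).of_isClosed_subset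
      (isClosed_iInter fun c => (hDcpt c).isClosed) (Set.iInter_subset _ _)
  · exact isPreconnected_iInter_of_directed D hdir hDcpt
      fun c => isPreconnected_connectedComponentIn.closure
  · exact Set.mem_iInter.2 fun c => subset_closure (mem_connectedComponentIn (hmem c).1)
  · exact Set.mem_iInter.2 fun c => subset_closure (hmem c).2
  · intro z hz
    refine le_of_forall_gt_imp_ge_of_dense fun c hc => ?_
    exact hDsub ⟨c, hc⟩ (Set.mem_iInter.1 hz ⟨c, hc⟩)
  · intro K' hK' hconn haK hbK
    obtain ⟨z, hzK, hz⟩ := hK'.exists_isMaxOn ⟨a, haK⟩ hf.continuousOn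
    exact ⟨z, hzK, csInf_le hCbdd ⟨K', hK', hconn, haK, hbK, fun w hw => hz hw⟩⟩

/-! ### Gradient descent, second-order conditions and the mountain pass principle. -/

section Hilbert
variable {H : Type*} [NormedAddCommGroup H] [InnerProductSpace ℝ H]

/-- A step of gradient descent, uniform on a compact set. -/
theorem exists_gradient_step [FiniteDimensional ℝ H] {f : H → ℝ} (hf : ContDiff ℝ 2 f)
    {K : Set H} (hK : IsCompact K) :
    ∃ t : ℝ, 0 < t ∧ ∀ z ∈ K, f (z - t • gradient f z) ≤ f z - t / 2 * ‖gradient f z‖ ^ 2 := by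
  have hgrad : Continuous (gradient f) :=
    (InnerProductSpace.toDual ℝ H).symm.continuous.comp (hf.continuous_fderiv (by norm_num))
  obtain ⟨R₁, hR₁⟩ := hK.isBounded.exists_norm_le
  obtain ⟨R₂, hR₂⟩ := (hK.image hgrad).isBounded.exists_norm_le
  have hf1 : ContDiff ℝ 1 (fderiv ℝ f) := hf.fderiv_right (by norm_num)
  obtain ⟨C, hC⟩ := ((isCompact_closedBall (0 : H) (R₁ + R₂)).image
    (hf1.continuous_fderiv (by norm_num))).isBounded.exists_norm_le
  have hCnn : ∀ z ∈ Metric.closedBall (0 : H) (R₁ + R₂), ‖fderiv ℝ (fderiv ℝ f) z‖ ≤ |C| :=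
    fun z hz => (hC _ ⟨z, hz, rfl⟩).trans (le_abs_self C)
  have hpos : 0 < 2 * (|C| + 1) := by positivity
  -- Since `t ≤ 1`, the step stays in the ball where `|C|` bounds the Hessian; since `t * |C| ≤ 1 /
  -- 2`, the second-order error costs at most half of the gain `t * ‖g‖ ^ 2`.
  refine ⟨1 / (2 * (|C| + 1)), by positivity, fun z hz => ?_⟩
  set t : ℝ := 1 / (2 * (|C| + 1)) with ht
  have ht0 : 0 < t := by positivity
  have ht1 : t ≤ 1 := by
    rw [ht, div_le_one hpos]; linarith [abs_nonneg C]
  have htC : t * |C| ≤ 1 / 2 := by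
    rw [ht, div_mul_eq_mul_div, div_le_iff₀ hpos]; linarith [abs_nonneg C]
  set g := gradient f z with hg
  have hgn : ‖g‖ ≤ R₂ := hR₂ _ ⟨z, hz, rfl⟩
  have hball : ∀ w ∈ segment ℝ z (z - t • g), w ∈ Metric.closedBall (0 : H) (R₁ + R₂) := by
    refine (convex_closedBall (0 : H) (R₁ + R₂)).segment_subset ?_ ?_
    · rw [mem_closedBall_zero_iff]; linarith [hR₁ z hz, norm_nonneg g]
    · rw [mem_closedBall_zero_iff]
      calc ‖z - t • g‖ ≤ ‖z‖ + ‖t • g‖ := norm_sub_le _ _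
        _ ≤ R₁ + R₂ := by
          rw [norm_smul, Real.norm_of_nonneg ht0.le]
          nlinarith [hR₁ z hz, norm_nonneg g]
  obtain ⟨ξ, hξ, hξeq⟩ := domain_mvt (f := f) (f' := fderiv ℝ f) (s := Set.univ) (x := z)
    (y := z - t • g)
    (fun x _ => ((hf.differentiable (by norm_num)) x).hasFDerivAt.hasFDerivWithinAt)
    convex_univ trivial trivial
  have hlip : ‖fderiv ℝ f ξ - fderiv ℝ f z‖ ≤ |C| * ‖ξ - z‖ :=
    (convex_closedBall (0 : H) (R₁ + R₂)).norm_image_sub_le_of_norm_fderiv_le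
      (fun x _ => (hf1.differentiable (by norm_num)) x) hCnn
      (hball z (left_mem_segment ℝ _ _)) (hball ξ hξ)
  have hξz : ‖ξ - z‖ ≤ t * ‖g‖ := by
    have h := norm_sub_le_of_mem_segment hξ
    simpa [norm_smul, abs_of_pos ht0] using h
  have hfg : fderiv ℝ f z g = ‖g‖ ^ 2 := by
    rw [← toDual_gradient, InnerProductSpace.toDual_apply_apply, ← hg,
      real_inner_self_eq_norm_sq]
  have hdiff : |(fderiv ℝ f ξ - fderiv ℝ f z) g| ≤ |C| * (t * ‖g‖) * ‖g‖ :=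
    (ContinuousLinearMap.le_opNorm _ g).trans
      (mul_le_mul_of_nonneg_right (hlip.trans (by gcongr)) (norm_nonneg g))
  have hval : f (z - t • g) - f z = -t * fderiv ℝ f ξ g := by
    rw [hξeq]; simp
  rw [sub_apply, hfg] at hdiff
  have h1 := (abs_le.1 hdiff).1
  have h2 : |C| * (t * ‖g‖) * ‖g‖ = (t * |C|) * ‖g‖ ^ 2 := by ring
  have h3 : (t * |C|) * ‖g‖ ^ 2 ≤ 1 / 2 * ‖g‖ ^ 2 := by gcongr
  nlinarith

end Hilbert

section Normed
variable {H : Type*} [NormedAddCommGroup H] [NormedSpace ℝ H]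

/-- Compactness of the unit sphere and homogeneity. The margin `m` is what lets definiteness survive
small perturbations of `B`. -/
theorem exists_norm_sq_le_of_pos_def [FiniteDimensional ℝ H] (B : H →L[ℝ] H →L[ℝ] ℝ)
    (hB : ∀ w, w ≠ 0 → 0 < B w w) : ∃ m : ℝ, 0 < m ∧ ∀ w, m * ‖w‖ ^ 2 ≤ B w w := by
  have hcont : Continuous fun w => B w w := by fun_prop
  rcases subsingleton_or_nontrivial H with h | h
  · exact ⟨1, one_pos, fun w => by simp [Subsingleton.elim w 0]⟩
  obtain ⟨u, hu, hmin⟩ := (isCompact_sphere (0 : H) 1).exists_isMinOn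
    (NormedSpace.sphere_nonempty.2 zero_le_one) hcont.continuousOn
  have hu0 : u ≠ 0 := by
    rintro rfl
    simp at hu
  refine ⟨B u u, hB u hu0, fun w => ?_⟩
  rcases eq_or_ne w 0 with rfl | hw
  · simp
  have hw' : ‖w‖ ≠ 0 := norm_ne_zero_iff.2 hw
  have h : B u u ≤ B (‖w‖⁻¹ • w) (‖w‖⁻¹ • w) := hmin (by simp [norm_smul, hw'])
  simp only [map_smul, smul_eq_mul, smul_apply] at h
  calc B u u * ‖w‖ ^ 2 ≤ (‖w‖⁻¹ * (‖w‖⁻¹ * B w w)) * ‖w‖ ^ 2 := by gcongr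
    _ = B w w := by field_simp

/-- Strict second-order sufficient condition for a strict local minimum. -/
theorem eventually_lt_of_pos_def_hessian [FiniteDimensional ℝ H] {f : H → ℝ}
    (hf : ContDiff ℝ 2 f) {z : H} (hz : fderiv ℝ f z = 0)
    (hB : ∀ w, w ≠ 0 → 0 < fderiv ℝ (fderiv ℝ f) z w w) :
    ∃ ε : ℝ, 0 < ε ∧ ∀ w ∈ Metric.ball z ε, w ≠ z → f z < f w := by
  obtain ⟨m, hm, hmB⟩ := exists_norm_sq_le_of_pos_def _ hB
  have hf1 : ContDiff ℝ 1 (fderiv ℝ f) := hf.fderiv_right (by norm_num)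
  have hD := hf1.continuous_fderiv (by norm_num)
  obtain ⟨ε, hε, hball⟩ := Metric.continuousAt_iff.1 (hD.continuousAt (x := z)) m hm
  refine ⟨ε, hε, fun w hw hwz => ?_⟩
  have h4 : 0 < ‖w - z‖ := norm_pos_iff.2 (sub_ne_zero.2 hwz)
  have hpos : ∀ ζ ∈ Metric.ball z ε, 0 < fderiv ℝ (fderiv ℝ f) ζ (w - z) (w - z) := by
    intro ζ hζ
    have h1 := hball (Metric.mem_ball.1 hζ)
    rw [dist_eq_norm] at h1
    have h2 : |(fderiv ℝ (fderiv ℝ f) ζ - fderiv ℝ (fderiv ℝ f) z) (w - z) (w - z)| ≤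
        ‖fderiv ℝ (fderiv ℝ f) ζ - fderiv ℝ (fderiv ℝ f) z‖ * ‖w - z‖ * ‖w - z‖ :=
      (Real.norm_eq_abs _).ge.trans (ContinuousLinearMap.le_opNorm₂ _ _ _)
    have h3 := hmB (w - z)
    have h5 := (abs_le.1 h2).1
    simp only [sub_apply] at h5
    nlinarith [mul_lt_mul_of_pos_right h1 (mul_pos h4 h4)]
  have hline : ∀ t : ℝ, HasDerivAt (fun t : ℝ => z + t • (w - z)) (w - z) t := fun t => by
    simpa using ((hasDerivAt_id t).smul_const (w - z)).const_add z
  have hφ : ∀ t : ℝ, HasDerivAt (fun t : ℝ => f (z + t • (w - z)))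
      (fderiv ℝ f (z + t • (w - z)) (w - z)) t := fun t =>
    ((hf.differentiable (by norm_num)) _).hasFDerivAt.comp_hasDerivAt t (hline t)
  have hφ' : ∀ t : ℝ, HasDerivAt (fun t : ℝ => fderiv ℝ f (z + t • (w - z)) (w - z))
      (fderiv ℝ (fderiv ℝ f) (z + t • (w - z)) (w - z) (w - z)) t := fun t =>
    (((hf1.differentiable (by norm_num)) _).hasFDerivAt.comp_hasDerivAt t (hline t)).clm_apply
      (hasDerivAt_const t (w - z)) |>.congr_deriv (by simp)
  -- Second-order Taylor by two mean values along the segment, using that the first derivative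
  -- vanishes at `z`.
  obtain ⟨t, ht, hteq⟩ := exists_hasDerivAt_eq_slope _ _ zero_lt_one
    (fun s _ => (hφ s).continuousAt.continuousWithinAt) (fun s _ => hφ s)
  obtain ⟨s, hs, hseq⟩ := exists_hasDerivAt_eq_slope _ _ ht.1
    (fun s _ => (hφ' s).continuousAt.continuousWithinAt) (fun s _ => hφ' s)
  have hsball : z + s • (w - z) ∈ Metric.ball z ε := by
    rw [mem_ball_iff_norm] at hw ⊢
    rw [add_sub_cancel_left, norm_smul, Real.norm_of_nonneg hs.1.le]
    nlinarith [hs.2, ht.2]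
  have h6 := hpos _ hsball
  rw [hseq] at h6
  simp only [zero_smul, add_zero, hz, zero_apply, sub_zero] at h6
  have h7 := (div_pos_iff_of_pos_right ht.1).1 h6
  rw [hteq] at h7
  simpa using h7

/-- A strict version of the mountain pass principle: a coercive function whose critical points are
all nondegenerate local minima has at most one critical point. -/
theorem eq_of_fderiv_eq_zero_of_pos_def_hessian {H : Type*} [NormedAddCommGroup H]
    [InnerProductSpace ℝ H] [FiniteDimensional ℝ H] {f : H → ℝ}
    (hf : ContDiff ℝ 2 f) (hcpt : ∀ c, IsCompact {z | f z ≤ c})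
    (hB : ∀ z, fderiv ℝ f z = 0 → ∀ w, w ≠ 0 → 0 < fderiv ℝ (fderiv ℝ f) z w w)
    {a b : H} (ha : fderiv ℝ f a = 0) (hb : fderiv ℝ f b = 0) : a = b := by
  by_contra hab
  obtain ⟨c, K, hK, hconn, haK, hbK, hKc, hmin⟩ :=
    exists_isCompact_isPreconnected_min_level hf.continuous hcpt
      (K₀ := segment ℝ a b) (by
        rw [segment_eq_image' ℝ a b]
        exact isCompact_Icc.image (by fun_prop)) (convex_segment a b).isPreconnected
      (left_mem_segment ℝ a b) (right_mem_segment ℝ a b)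
  -- A critical point of `K` at the top level would be a strict local minimum, hence isolated in
  -- `K`; but `K` is connected and contains another point.
  have hcrit : ∀ z ∈ K, f z = c → fderiv ℝ f z ≠ 0 := by
    intro z hzK hzc hz
    obtain ⟨ε, hε, hlt⟩ := eventually_lt_of_pos_def_hessian hf hz (hB z hz)
    obtain ⟨q, hqK, hq⟩ : ∃ q ∈ K, q ≠ z := by
      by_cases h : a = z
      · exact ⟨b, hbK, fun h' => hab (h.trans h'.symm)⟩
      · exact ⟨a, haK, h⟩
    obtain ⟨y, hyK, hyb, hyz⟩ := hconn (Metric.ball z ε) {z}ᶜ Metric.isOpen_ball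
      isClosed_singleton.isOpen_compl (fun y _ => by
        by_cases h : y = z
        · exact Or.inl (h ▸ Metric.mem_ball_self hε)
        · exact Or.inr h) ⟨z, hzK, Metric.mem_ball_self hε⟩ ⟨q, hqK, hq⟩
    exact absurd (hKc y hyK) (not_le.2 (hzc ▸ hlt y hyb hyz))
  obtain ⟨t, ht, hstep⟩ := exists_gradient_step hf hK
  have hgrad : Continuous (gradient f) :=
    (InnerProductSpace.toDual ℝ H).symm.continuous.comp (hf.continuous_fderiv (by norm_num))
  have hT : Continuous fun z => z - t • gradient f z := by fun_prop
  have hfix : ∀ z, fderiv ℝ f z = 0 → z - t • gradient f z = z := fun z hz => by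
    simp [gradient, hz]
  -- The gradient step fixes `a` and `b`, so the image of `K` still joins them; it lies strictly
  -- below `c`, against the minimality of `c`.
  obtain ⟨_, ⟨z, hzK, rfl⟩, hz⟩ := hmin _ (hK.image hT) (hconn.image _ hT.continuousOn)
    ⟨a, haK, hfix a ha⟩ ⟨b, hbK, hfix b hb⟩
  have h1 := hstep z hzK
  have h2 := hKc z hzK
  rcases h2.lt_or_eq with h3 | h3
  · nlinarith [mul_nonneg ht.le (sq_nonneg ‖gradient f z‖)]
  · have h4 : 0 < ‖gradient f z‖ := by
      rw [norm_pos_iff]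
      intro h
      refine hcrit z hzK h3 ?_
      rw [← toDual_gradient, h, map_zero]
    nlinarith [mul_pos ht (pow_pos h4 2)]

/-- Second-order necessary condition at a minimum. -/
theorem hessian_nonneg_of_forall_le {f : H → ℝ} (hf : ContDiff ℝ 2 f) {z : H}
    (hmin : ∀ w, f z ≤ f w) (w : H) : 0 ≤ fderiv ℝ (fderiv ℝ f) z w w := by
  have hf1 : ContDiff ℝ 1 (fderiv ℝ f) := hf.fderiv_right (by norm_num)
  have hline : ∀ t : ℝ, HasDerivAt (fun t : ℝ => z + t • w) w t := fun t => by
    simpa using ((hasDerivAt_id t).smul_const w).const_add z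
  have hφ : ∀ t : ℝ, HasDerivAt (fun t : ℝ => f (z + t • w))
      (fderiv ℝ f (z + t • w) w) t := fun t =>
    ((hf.differentiable (by norm_num)) _).hasFDerivAt.comp_hasDerivAt t (hline t)
  have hφ' : ∀ t : ℝ, HasDerivAt (fun t : ℝ => fderiv ℝ f (z + t • w) w)
      (fderiv ℝ (fderiv ℝ f) (z + t • w) w w) t := fun t =>
    (((hf1.differentiable (by norm_num)) _).hasFDerivAt.comp_hasDerivAt t (hline t)).clm_apply
      (hasDerivAt_const t w) |>.congr_deriv (by simp)
  set φ : ℝ → ℝ := fun t => f (z + t • w) with hφdef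
  have hd : deriv φ = fun t => fderiv ℝ f (z + t • w) w := funext fun t => (hφ t).deriv
  have hd2 : deriv (deriv φ) 0 = fderiv ℝ (fderiv ℝ f) z w w := by
    rw [hd, (hφ' 0).deriv]; simp
  have hlmin : IsLocalMin φ 0 := Filter.Eventually.of_forall fun t => by
    simpa [hφdef] using hmin (z + t • w)
  -- A negative second derivative would make `0` a local maximum as well, so `φ` would be locally
  -- constant with zero second derivative.
  by_contra hneg
  rw [not_le, ← hd2] at hneg
  have hlmax := isLocalMax_of_deriv_deriv_neg hneg hlmin.deriv_eq_zero (hφ 0).continuousAt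
  have hconst : φ =ᶠ[𝓝 0] fun _ => φ 0 := by
    filter_upwards [hlmin, hlmax] with t h1 h2 using le_antisymm h2 h1
  have h := hconst.deriv.deriv_eq
  simp at h
  linarith

/-- In a continuous family of symmetric nondegenerate bilinear forms over a connected parameter
space, all forms are positive definite as soon as one is positive semidefinite. -/
theorem pos_def_of_preconnected_family [FiniteDimensional ℝ H] {P : Type*} [TopologicalSpace P]
    [PreconnectedSpace P] (B : P → H →L[ℝ] H →L[ℝ] ℝ) (hB : Continuous B)
    (hsymm : ∀ p u w, B p u w = B p w u) (hnd : ∀ p u, (∀ w, B p u w = 0) → u = 0) (p₀ : P)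
    (hp₀ : ∀ w, 0 ≤ B p₀ w w) (p : P) (w : H) (hw : w ≠ 0) : 0 < B p w w := by
  -- Cauchy–Schwarz for a semidefinite form, through a discriminant: an isotropic vector lies in the
  -- kernel.
  have hpd : ∀ p, (∀ w, 0 ≤ B p w w) → ∀ w, w ≠ 0 → 0 < B p w w := by
    intro p hpsd u hu
    refine lt_of_le_of_ne (hpsd u) fun h0 => hu (hnd p u fun v => ?_)
    have hq : ∀ t : ℝ, 0 ≤ B p v v * (t * t) + 2 * B p u v * t + 0 := by
      intro t
      have h := hpsd (u + t • v)
      simp only [map_add, map_smul, add_apply, smul_apply, smul_eq_mul, ← h0, hsymm p v u] at h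
      linarith
    have h := discrim_le_zero hq
    rw [discrim] at h
    nlinarith [sq_nonneg (B p u v)]
  have hcont : ∀ w, Continuous fun p => B p w w := fun w => by fun_prop
  -- Semidefiniteness is a closed condition; it is open here because by `hpd` it amounts to
  -- definiteness.
  have hset : IsClopen {p | ∀ w, 0 ≤ B p w w} := by
    constructor
    · simp only [Set.ofPred_forall]
      exact isClosed_iInter fun w => isClosed_le continuous_const (hcont w)
    · rw [isOpen_iff_mem_nhds]
      intro q hq
      obtain ⟨m, hm, hmB⟩ := exists_norm_sq_le_of_pos_def (B q) (hpd q hq)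
      filter_upwards [hB.continuousAt (Metric.ball_mem_nhds (B q) hm)] with p hp w
      have h1 : ‖B p - B q‖ < m := mem_ball_iff_norm.1 hp
      have h2 : |(B p - B q) w w| ≤ ‖B p - B q‖ * ‖w‖ * ‖w‖ :=
        (Real.norm_eq_abs _).ge.trans (ContinuousLinearMap.le_opNorm₂ _ _ _)
      have h3 := (abs_le.1 h2).1
      simp only [sub_apply] at h3
      nlinarith [hmB w, mul_le_mul_of_nonneg_right h1.le (mul_self_nonneg ‖w‖)]
  have huniv := hset.eq_univ ⟨p₀, hp₀⟩
  exact hpd p (huniv ▸ Set.mem_univ p : p ∈ {p | ∀ w, 0 ≤ B p w w}) w hw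

end Normed

/-! ### Generating functions: periodicity, twist condition, growth. -/

section GeneratingFunction
variable {d : ℕ}

theorem intVec_apply (r : Fin d → ℤ) (i : Fin d) : intVec r i = (r i : ℝ) := rfl

theorem intVec_injective : Function.Injective (intVec : (Fin d → ℤ) → E d) := by
  intro r s h
  funext i
  have h1 := congrArg (fun v : E d => v i) h
  simpa [intVec_apply] using h1

/-- A compact set whose integer translates cover `ℝ^d`. -/
theorem exists_isCompact_forall_exists_add_intVec_mem (d : ℕ) :
    ∃ Q : Set (E d), IsCompact Q ∧ Q.Nonempty ∧ ∀ x, ∃ r : Fin d → ℤ, x + intVec r ∈ Q := by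
  refine ⟨WithLp.toLp 2 '' Set.Icc (0 : Fin d → ℝ) 1,
    isCompact_Icc.image (PiLp.continuous_toLp 2 _), ⟨_, 0, by simp, rfl⟩, fun x => ?_⟩
  refine ⟨fun i => -⌊x i⌋, fun i => x i + ((-⌊x i⌋ : ℤ) : ℝ), ⟨fun i => ?_, fun i => ?_⟩, ?_⟩
  · have := Int.floor_le (x i)
    simp only [Pi.zero_apply, Int.cast_neg]
    linarith
  · have := Int.lt_floor_add_one (x i)
    simp only [Pi.one_apply, Int.cast_neg]
    linarith
  · ext i
    simp [intVec_apply]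

theorem exists_norm_le_of_periodic {V : Type*} [NormedAddCommGroup V] {f : E d → V}
    (hf : Continuous f) (hper : ∀ (r : Fin d → ℤ) x, f (x + intVec r) = f x) :
    ∃ C : ℝ, ∀ x, ‖f x‖ ≤ C := by
  obtain ⟨Q, hQ, -, hcov⟩ := exists_isCompact_forall_exists_add_intVec_mem d
  obtain ⟨C, hC⟩ := (hQ.image hf).isBounded.exists_norm_le
  refine ⟨C, fun x => ?_⟩
  obtain ⟨r, hr⟩ := hcov x
  exact hper r x ▸ hC _ ⟨_, hr, rfl⟩

variable {S : E d × E d → ℝ}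

namespace IsGeneratingFunction

theorem differentiable (hS : IsGeneratingFunction S) : Differentiable ℝ S :=
  hS.contDiff.differentiable (by norm_num)

theorem contDiff_fderiv (hS : IsGeneratingFunction S) : ContDiff ℝ 1 (fderiv ℝ S) :=
  hS.contDiff.fderiv_right (by norm_num)

theorem hasFDerivAt_fderiv (hS : IsGeneratingFunction S) (z : E d × E d) :
    HasFDerivAt (fderiv ℝ S) (fderiv ℝ (fderiv ℝ S) z) z :=
  ((hS.contDiff_fderiv.differentiable (by norm_num)) z).hasFDerivAt

theorem hessian_symm (hS : IsGeneratingFunction S) (z u w : E d × E d) :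
    fderiv ℝ (fderiv ℝ S) z u w = fderiv ℝ (fderiv ℝ S) z w u :=
  (hS.contDiff.contDiffAt.isSymmSndFDerivAt (by simp)).eq u w

theorem d₁_apply (hS : IsGeneratingFunction S) (x y ξ : E d) :
    d₁ S x y ξ = fderiv ℝ S (x, y) (ξ, 0) := by
  have h : HasFDerivAt (fun u : E d => S (u, y))
      ((fderiv ℝ S (x, y)).comp (ContinuousLinearMap.inl ℝ (E d) (E d))) x :=
    (hS.differentiable (x, y)).hasFDerivAt.comp x (hasFDerivAt_prodMk_left x y)
  rw [d₁, h.fderiv]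
  simp

theorem d₂_apply (hS : IsGeneratingFunction S) (x y ξ : E d) :
    d₂ S x y ξ = fderiv ℝ S (x, y) (0, ξ) := by
  have h : HasFDerivAt (fun u : E d => S (x, u))
      ((fderiv ℝ S (x, y)).comp (ContinuousLinearMap.inr ℝ (E d) (E d))) y :=
    (hS.differentiable (x, y)).hasFDerivAt.comp y (hasFDerivAt_prodMk_right x y)
  rw [d₂, h.fderiv]
  simp

theorem d₁_eq (hS : IsGeneratingFunction S) (x y : E d) :
    d₁ S x y = (fderiv ℝ S (x, y)).comp (ContinuousLinearMap.inl ℝ (E d) (E d)) := by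
  ext1 ξ
  simp [hS.d₁_apply]

theorem d₂_eq (hS : IsGeneratingFunction S) (x y : E d) :
    d₂ S x y = (fderiv ℝ S (x, y)).comp (ContinuousLinearMap.inr ℝ (E d) (E d)) := by
  ext1 ξ
  simp [hS.d₂_apply]

theorem continuous_d₁ (hS : IsGeneratingFunction S) :
    Continuous fun z : E d × E d => d₁ S z.1 z.2 := by
  simp only [hS.d₁_eq]
  exact hS.contDiff_fderiv.continuous.clm_comp continuous_const

theorem continuous_d₂ (hS : IsGeneratingFunction S) :
    Continuous fun z : E d × E d => d₂ S z.1 z.2 := by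
  simp only [hS.d₂_eq]
  exact hS.contDiff_fderiv.continuous.clm_comp continuous_const

theorem fderiv_add_intVec (hS : IsGeneratingFunction S) (r : Fin d → ℤ) (x y : E d) :
    fderiv ℝ S (x + intVec r, y + intVec r) = fderiv ℝ S (x, y) := by
  have h : (fun z : E d × E d => S (z + (intVec r, intVec r))) = S :=
    funext fun z => hS.periodic r z.1 z.2
  have h1 := fderiv_comp_add_right (𝕜 := ℝ) (f := S) (x := (x, y)) (intVec r, intVec r)
  rw [h] at h1
  exact h1.symm

theorem d₁_add_intVec (hS : IsGeneratingFunction S) (r : Fin d → ℤ) (x y : E d) :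
    d₁ S (x + intVec r) (y + intVec r) = d₁ S x y := by
  rw [hS.d₁_eq, hS.d₁_eq, hS.fderiv_add_intVec]

theorem d₂_add_intVec (hS : IsGeneratingFunction S) (r : Fin d → ℤ) (x y : E d) :
    d₂ S (x + intVec r) (y + intVec r) = d₂ S x y := by
  rw [hS.d₂_eq, hS.d₂_eq, hS.fderiv_add_intVec]

/-- The twist condition makes `y ↦ -∂₁S(x, y)` uniformly monotone, uniformly in `x`. -/
theorem d₁_sub_apply_le (hS : IsGeneratingFunction S) {A : ℝ}
    (hA : ∀ x y ξ : E d, fderiv ℝ (fderiv ℝ S) (x, y) (ξ, 0) (0, ξ) ≤ -A * ‖ξ‖ ^ 2)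
    (x y y' : E d) : (d₁ S x y' - d₁ S x y) (y' - y) ≤ -A * ‖y' - y‖ ^ 2 := by
  have hder : ∀ w ∈ Set.univ, HasFDerivWithinAt (fun w => fderiv ℝ S (x, w) (y' - y, 0))
      ((ContinuousLinearMap.apply ℝ ℝ ((y' - y, 0) : E d × E d)).comp
        ((fderiv ℝ (fderiv ℝ S) (x, w)).comp (ContinuousLinearMap.inr ℝ (E d) (E d))))
      Set.univ w := fun w _ =>
    ((ContinuousLinearMap.apply ℝ ℝ ((y' - y, 0) : E d × E d)).hasFDerivAt.comp w
      ((hS.hasFDerivAt_fderiv (x, w)).comp w (hasFDerivAt_prodMk_right x w))).hasFDerivWithinAt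
  obtain ⟨ζ, -, hζ⟩ := domain_mvt hder convex_univ (x := y) (y := y') trivial trivial
  rw [sub_apply, hS.d₁_apply, hS.d₁_apply, hζ]
  simpa [hS.hessian_symm (x, ζ) (0, y' - y) (y' - y, 0)] using hA x ζ (y' - y)

theorem d₂_sub_apply_le (hS : IsGeneratingFunction S) {A : ℝ}
    (hA : ∀ x y ξ : E d, fderiv ℝ (fderiv ℝ S) (x, y) (ξ, 0) (0, ξ) ≤ -A * ‖ξ‖ ^ 2)
    (x x' y : E d) : (d₂ S x' y - d₂ S x y) (x' - x) ≤ -A * ‖x' - x‖ ^ 2 := by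
  have hder : ∀ w ∈ Set.univ, HasFDerivWithinAt (fun w => fderiv ℝ S (w, y) (0, x' - x))
      ((ContinuousLinearMap.apply ℝ ℝ ((0, x' - x) : E d × E d)).comp
        ((fderiv ℝ (fderiv ℝ S) (w, y)).comp (ContinuousLinearMap.inl ℝ (E d) (E d))))
      Set.univ w := fun w _ =>
    ((ContinuousLinearMap.apply ℝ ℝ ((0, x' - x) : E d × E d)).hasFDerivAt.comp w
      ((hS.hasFDerivAt_fderiv (w, y)).comp w (hasFDerivAt_prodMk_left w y))).hasFDerivWithinAt
  obtain ⟨ζ, -, hζ⟩ := domain_mvt hder convex_univ (x := x) (y := x') trivial trivial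
  rw [sub_apply, hS.d₂_apply, hS.d₂_apply, hζ]
  simpa using hA ζ y (x' - x)

/-- The operator norm bound turns monotonicity into expansion: for fixed `x`, the point `y` is a
Lipschitz function of `d₁ S x y`. -/
theorem exists_mul_norm_sub_le (hS : IsGeneratingFunction S) :
    ∃ A : ℝ, 0 < A ∧ ∀ x y y', A * ‖y' - y‖ ≤ ‖d₁ S x y' - d₁ S x y‖ := by
  obtain ⟨A, hA0, hA⟩ := hS.twist
  refine ⟨A, hA0, fun x y y' => ?_⟩
  rcases eq_or_ne y' y with rfl | hne
  · simp
  have h1 := hS.d₁_sub_apply_le hA x y y'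
  have h2 := (abs_le.1 ((Real.norm_eq_abs _).ge.trans
    ((d₁ S x y' - d₁ S x y).le_opNorm (y' - y)))).1
  have h3 : 0 < ‖y' - y‖ := norm_pos_iff.2 (sub_ne_zero.2 hne)
  refine le_of_mul_le_mul_right ?_ h3
  nlinarith

/-- The mixed second derivative is nondegenerate. -/
theorem eq_zero_of_hessian_snd_fst (hS : IsGeneratingFunction S) (z : E d × E d) {ξ : E d}
    (h : fderiv ℝ (fderiv ℝ S) z (0, ξ) (ξ, 0) = 0) : ξ = 0 := by
  obtain ⟨A, hA0, hA⟩ := hS.twist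
  have h1 := hA z.1 z.2 ξ
  rw [← hS.hessian_symm, h] at h1
  by_contra h3
  nlinarith [mul_pos hA0 (pow_pos (norm_pos_iff.2 h3) 2)]

/-- A generating function is superlinear in `y - x`; only linear growth is recorded. -/
theorem exists_norm_sub_le (hS : IsGeneratingFunction S) :
    ∃ β : ℝ, 0 ≤ β ∧ ∀ x y : E d, ‖y - x‖ - β ≤ S (x, y) := by
  obtain ⟨A, hA0, hA⟩ := hS.twist
  obtain ⟨C, hC⟩ := exists_norm_le_of_periodic (f := fun x => S (x, x))
    (hS.contDiff.continuous.comp (by fun_prop)) (fun r x => hS.periodic r x x)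
  obtain ⟨B, hB⟩ := exists_norm_le_of_periodic (f := fun x => d₂ S x x)
    (hS.continuous_d₂.comp (f := fun x => (x, x)) (by fun_prop))
    (fun r x => hS.d₂_add_intVec r x x)
  have hC0 : 0 ≤ C := (norm_nonneg _).trans (hC 0)
  -- `C` bounds `S` and `B` bounds `d₂ S` on the diagonal; the last term completes the square in `A
  -- / 4 * ‖u‖ ^ 2 - (B + 1) * ‖u‖`.
  refine ⟨C + (B + 1) ^ 2 / A, by positivity, fun x y => ?_⟩
  set u := y - x with hu
  have hderiv : ∀ t : ℝ, HasDerivAt (fun t : ℝ => S (x, x + t • u)) (d₂ S x (x + t • u) u) t := by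
    intro t
    have hline : HasDerivAt (fun t : ℝ => (x, x + t • u)) ((0, u) : E d × E d) t :=
      (hasDerivAt_const t x).prodMk (by simpa using ((hasDerivAt_id t).smul_const u).const_add x)
    rw [hS.d₂_apply]
    exact (hS.differentiable _).hasFDerivAt.comp_hasDerivAt t hline
  -- Compare with the diagonal point `(x + t • u, x + t • u)` by monotonicity in the first variable,
  -- then divide by `t`.
  have hlow : ∀ t : ℝ, 0 < t → -B * ‖u‖ + t * (A * ‖u‖ ^ 2) ≤ d₂ S x (x + t • u) u := by
    intro t ht
    have h1 := hS.d₂_sub_apply_le hA x (x + t • u) (x + t • u)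
    have h2 := (abs_le.1 ((Real.norm_eq_abs _).ge.trans
      ((d₂ S (x + t • u) (x + t • u)).le_opNorm u))).1
    have h3 := mul_le_mul_of_nonneg_right (hB (x + t • u)) (norm_nonneg u)
    rw [add_sub_cancel_left, norm_smul, Real.norm_of_nonneg ht.le, map_smul, sub_apply,
      smul_eq_mul] at h1
    have h4 : t * (d₂ S (x + t • u) (x + t • u) u + t * (A * ‖u‖ ^ 2))
        ≤ t * d₂ S x (x + t • u) u := by nlinarith
    have h5 := le_of_mul_le_mul_left h4 ht
    linarith
  -- A mean value over the whole interval would give no lower bound on `t`; on the second half `t' >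
  -- 1 / 2` retains a quadratic gain.
  obtain ⟨t, ht, hteq⟩ := exists_hasDerivAt_eq_slope _ _ (show (0 : ℝ) < 1 / 2 by norm_num)
    (fun s _ => (hderiv s).continuousAt.continuousWithinAt) (fun s _ => hderiv s)
  obtain ⟨t', ht', hteq'⟩ := exists_hasDerivAt_eq_slope _ _ (show (1 / 2 : ℝ) < 1 by norm_num)
    (fun s _ => (hderiv s).continuousAt.continuousWithinAt) (fun s _ => hderiv s)
  have h1 := hlow t ht.1
  have h2 := hlow t' (by linarith [ht'.1])
  rw [hteq, le_div_iff₀ (by norm_num)] at h1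
  rw [hteq', le_div_iff₀ (by norm_num)] at h2
  simp only [zero_smul, one_smul, add_zero] at h1 h2
  have hy : x + u = y := by rw [hu]; abel
  rw [hy] at h2
  have h3 := (abs_le.1 ((Real.norm_eq_abs _).ge.trans (hC x))).1
  have hAu : 0 ≤ A * ‖u‖ ^ 2 := by positivity
  have h4 : 0 ≤ t * (A * ‖u‖ ^ 2) := mul_nonneg ht.1.le hAu
  have h5 : 1 / 2 * (A * ‖u‖ ^ 2) ≤ t' * (A * ‖u‖ ^ 2) :=
    mul_le_mul_of_nonneg_right ht'.1.le hAu
  have h6 : (B + 1) * ‖u‖ ≤ A / 4 * ‖u‖ ^ 2 + (B + 1) ^ 2 / A := by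
    have : A / 4 * ‖u‖ ^ 2 + (B + 1) ^ 2 / A - (B + 1) * ‖u‖
        = (A * ‖u‖ / 2 - (B + 1)) ^ 2 / A := by
      field_simp
      ring
    have h7 : 0 ≤ (A * ‖u‖ / 2 - (B + 1)) ^ 2 / A := by positivity
    linarith
  linarith

end IsGeneratingFunction

/-! ### The generated map and its linearization. -/

variable {Φ : Cot d → Cot d}

namespace IsGeneratedBy

theorem snd_eq (hΦ : IsGeneratedBy Φ S) (z : Cot d) : z.2 = -d₁ S z.1 (Φ z).1 :=
  ((hΦ z.1 z.2 (Φ z).1 (Φ z).2).1 rfl).1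

theorem apply_snd_eq (hΦ : IsGeneratedBy Φ S) (z : Cot d) : (Φ z).2 = d₂ S z.1 (Φ z).1 :=
  ((hΦ z.1 z.2 (Φ z).1 (Φ z).2).1 rfl).2

theorem apply_eq (hΦ : IsGeneratedBy Φ S) (x y : E d) :
    Φ (x, -d₁ S x y) = (y, d₂ S x y) :=
  (hΦ _ _ _ _).2 ⟨rfl, rfl⟩

/-- By expansion, the displacement of the image position is controlled by the defect of the old
position in the new implicit equation; this defect is continuous and vanishes at the base point. -/
theorem continuous_fst (hΦ : IsGeneratedBy Φ S) (hS : IsGeneratingFunction S) :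
    Continuous fun z => (Φ z).1 := by
  obtain ⟨A, hA0, hA⟩ := hS.exists_mul_norm_sub_le
  rw [continuous_iff_continuousAt]
  intro z
  have hbound : ∀ w, ‖(Φ w).1 - (Φ z).1‖ ≤ A⁻¹ * ‖-w.2 - d₁ S w.1 (Φ z).1‖ := by
    intro w
    rw [hΦ.snd_eq w, neg_neg, ← div_eq_inv_mul, le_div_iff₀ hA0, mul_comm]
    exact hA _ _ _
  have hcont : Continuous fun w : Cot d => A⁻¹ * ‖-w.2 - d₁ S w.1 (Φ z).1‖ :=
    continuous_const.mul ((continuous_snd.neg.sub (hS.continuous_d₁.comp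
      (f := fun w : Cot d => (w.1, (Φ z).1)) (by fun_prop))).norm)
  have hzero : A⁻¹ * ‖-z.2 - d₁ S z.1 (Φ z).1‖ = 0 := by
    rw [hΦ.snd_eq z]; simp
  rw [ContinuousAt, tendsto_iff_norm_sub_tendsto_zero]
  refine squeeze_zero (fun w => norm_nonneg _) hbound ?_
  have h := hcont.tendsto z
  rwa [hzero] at h

/-- The linearized equations satisfied by the differential of the generated map. -/
theorem snd_eq_of_hasFDerivAt (hΦ : IsGeneratedBy Φ S) (hS : IsGeneratingFunction S)
    {z : Cot d} {L : Cot d →L[ℝ] Cot d} (hL : HasFDerivAt Φ L z) (ζ : Cot d) (w : E d) :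
    ζ.2 w = -fderiv ℝ (fderiv ℝ S) (z.1, (Φ z).1) (ζ.1, (L ζ).1) (w, 0) := by
  have hin : HasFDerivAt (fun z : Cot d => (z.1, (Φ z).1)) _ z := hasFDerivAt_fst.prodMk hL.fst
  have h1 : HasFDerivAt (fun z : Cot d => -fderiv ℝ S (z.1, (Φ z).1) (w, 0)) _ z :=
    ((ContinuousLinearMap.apply ℝ ℝ ((w, 0) : E d × E d)).hasFDerivAt.comp z
      ((hS.hasFDerivAt_fderiv _).comp z hin)).neg
  have h2 : HasFDerivAt (fun z : Cot d => z.2 w) _ z :=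
    (ContinuousLinearMap.apply ℝ ℝ w).hasFDerivAt.comp z hasFDerivAt_snd
  have heq : (fun z : Cot d => z.2 w) = fun z : Cot d => -fderiv ℝ S (z.1, (Φ z).1) (w, 0) := by
    funext z
    conv_lhs => rw [hΦ.snd_eq z]
    rw [neg_apply, hS.d₁_apply]
  rw [heq] at h2
  have h3 := congrArg (fun M => M ζ) (h2.unique h1)
  simpa using h3

theorem apply_snd_of_hasFDerivAt (hΦ : IsGeneratedBy Φ S) (hS : IsGeneratingFunction S)
    {z : Cot d} {L : Cot d →L[ℝ] Cot d} (hL : HasFDerivAt Φ L z) (ζ : Cot d) (w : E d) :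
    (L ζ).2 w = fderiv ℝ (fderiv ℝ S) (z.1, (Φ z).1) (ζ.1, (L ζ).1) (0, w) := by
  have hin : HasFDerivAt (fun z : Cot d => (z.1, (Φ z).1)) _ z := hasFDerivAt_fst.prodMk hL.fst
  have h1 : HasFDerivAt (fun z : Cot d => fderiv ℝ S (z.1, (Φ z).1) (0, w)) _ z :=
    ((ContinuousLinearMap.apply ℝ ℝ ((0, w) : E d × E d)).hasFDerivAt.comp z
      ((hS.hasFDerivAt_fderiv _).comp z hin))
  have h2 : HasFDerivAt (fun z : Cot d => (Φ z).2 w) _ z :=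
    (ContinuousLinearMap.apply ℝ ℝ w).hasFDerivAt.comp z hL.snd
  have heq : (fun z : Cot d => (Φ z).2 w) = fun z : Cot d => fderiv ℝ S (z.1, (Φ z).1) (0, w) := by
    funext z
    rw [hΦ.apply_snd_eq z, hS.d₂_apply]
  rw [heq] at h2
  have h3 := congrArg (fun M => M ζ) (h2.unique h1)
  simpa using h3

/-- The differential of the generated map is characterized by the linearized equations. -/
theorem eq_of_hasFDerivAt (hΦ : IsGeneratedBy Φ S) (hS : IsGeneratingFunction S)
    {z : Cot d} {L : Cot d →L[ℝ] Cot d} (hL : HasFDerivAt Φ L z) (ζ ζ' : Cot d)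
    (h₁ : ∀ w, ζ.2 w = -fderiv ℝ (fderiv ℝ S) (z.1, (Φ z).1) (ζ.1, ζ'.1) (w, 0))
    (h₂ : ∀ w, ζ'.2 w = fderiv ℝ (fderiv ℝ S) (z.1, (Φ z).1) (ζ.1, ζ'.1) (0, w)) :
    L ζ = ζ' := by
  have hfst : (L ζ).1 = ζ'.1 := by
    refine sub_eq_zero.1 (hS.eq_zero_of_hessian_snd_fst (z.1, (Φ z).1) ?_)
    have h := (h₁ ((L ζ).1 - ζ'.1)).symm.trans (hΦ.snd_eq_of_hasFDerivAt hS hL ζ _)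
    have h3 : ((0, (L ζ).1 - ζ'.1) : E d × E d) = (ζ.1, (L ζ).1) - (ζ.1, ζ'.1) := by simp
    conv_lhs => rw [h3]
    rw [map_sub, sub_apply]
    linarith
  refine Prod.ext hfst (ContinuousLinearMap.ext fun w => ?_)
  rw [h₂, hΦ.apply_snd_of_hasFDerivAt hS hL, hfst]

/-- The equation for the final momentum kills `ζ.1` by the twist condition; the one for the initial
momentum then kills `ζ.2`. -/
theorem eq_zero_of_hasFDerivAt (hΦ : IsGeneratedBy Φ S) (hS : IsGeneratingFunction S)
    {z : Cot d} {L : Cot d →L[ℝ] Cot d} (hL : HasFDerivAt Φ L z) {ζ : Cot d} (h : L ζ = 0) :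
    ζ = 0 := by
  have h2 := hΦ.apply_snd_of_hasFDerivAt hS hL ζ
  simp only [h, Prod.fst_zero, Prod.snd_zero] at h2
  have hfst : ζ.1 = 0 := by
    refine hS.eq_zero_of_hessian_snd_fst (z.1, (Φ z).1) ?_
    rw [hS.hessian_symm, ← h2 ζ.1]
    simp
  refine Prod.ext hfst (ContinuousLinearMap.ext fun w => ?_)
  have h1 := hΦ.snd_eq_of_hasFDerivAt hS hL ζ w
  rw [h1, hfst, h]
  change -fderiv ℝ (fderiv ℝ S) (z.1, (Φ z).1) (0 : E d × E d) (w, 0) = 0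
  simp

end IsGeneratedBy

end GeneratingFunction

/-! ### First and second derivatives of sums and affine restrictions. -/

section Calculus
variable {G G' : Type*} [NormedAddCommGroup G] [NormedSpace ℝ G] [NormedAddCommGroup G']
  [NormedSpace ℝ G']

theorem fderiv_sum_comp_clm {f : G' → ℝ} (hf : ContDiff ℝ 2 f) (ℓ : ℕ → G →L[ℝ] G') (m : ℕ)
    (g w : G) : fderiv ℝ (fun g => ∑ i ∈ Finset.range m, f (ℓ i g)) g w =
      ∑ i ∈ Finset.range m, fderiv ℝ f (ℓ i g) (ℓ i w) := by
  have h : HasFDerivAt (fun g => ∑ i ∈ Finset.range m, f (ℓ i g))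
      (∑ i ∈ Finset.range m, (fderiv ℝ f (ℓ i g)).comp (ℓ i)) g :=
    HasFDerivAt.fun_sum fun i _ =>
      (hf.differentiable (by norm_num) (ℓ i g)).hasFDerivAt.comp g (ℓ i).hasFDerivAt
  rw [h.fderiv]
  simp

theorem hasFDerivAt_fderiv_apply {f : G → ℝ} (hf : ContDiff ℝ 2 f) (g w : G) :
    HasFDerivAt (fun g => fderiv ℝ f g w)
      ((ContinuousLinearMap.apply ℝ ℝ w).comp (fderiv ℝ (fderiv ℝ f) g)) g :=
  (ContinuousLinearMap.apply ℝ ℝ w).hasFDerivAt.comp g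
    ((hf.fderiv_right (m := 1) (by norm_num)).differentiable (by norm_num) g).hasFDerivAt

theorem fderiv_fderiv_sum_comp_clm {f : G' → ℝ} (hf : ContDiff ℝ 2 f) (ℓ : ℕ → G →L[ℝ] G')
    (m : ℕ) (g u w : G) :
    fderiv ℝ (fderiv ℝ (fun g => ∑ i ∈ Finset.range m, f (ℓ i g))) g u w =
      ∑ i ∈ Finset.range m, fderiv ℝ (fderiv ℝ f) (ℓ i g) (ℓ i u) (ℓ i w) := by
  have hF : ContDiff ℝ 2 (fun g => ∑ i ∈ Finset.range m, f (ℓ i g)) :=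
    ContDiff.sum fun i _ => hf.comp (ℓ i).contDiff
  have h1 := hasFDerivAt_fderiv_apply hF g w
  have h2 : HasFDerivAt (fun g => ∑ i ∈ Finset.range m, fderiv ℝ f (ℓ i g) (ℓ i w))
      (∑ i ∈ Finset.range m, ((ContinuousLinearMap.apply ℝ ℝ (ℓ i w)).comp
        (fderiv ℝ (fderiv ℝ f) (ℓ i g))).comp (ℓ i)) g :=
    HasFDerivAt.fun_sum fun i _ =>
      (hasFDerivAt_fderiv_apply hf (ℓ i g) (ℓ i w)).comp g (ℓ i).hasFDerivAt
  simp only [fderiv_sum_comp_clm hf] at h1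
  have h3 := congrArg (fun M => M u) (h1.unique h2)
  simpa using h3

theorem fderiv_comp_affine {f : G' → ℝ} (hf : ContDiff ℝ 2 f) (a : G') (ℓ : G →L[ℝ] G')
    (g w : G) : fderiv ℝ (fun g => f (a + ℓ g)) g w = fderiv ℝ f (a + ℓ g) (ℓ w) := by
  have h : HasFDerivAt (fun g => f (a + ℓ g)) ((fderiv ℝ f (a + ℓ g)).comp ℓ) g :=
    (hf.differentiable (by norm_num) (a + ℓ g)).hasFDerivAt.comp g (ℓ.hasFDerivAt.const_add a)
  rw [h.fderiv]
  simp

theorem fderiv_fderiv_comp_affine {f : G' → ℝ} (hf : ContDiff ℝ 2 f) (a : G') (ℓ : G →L[ℝ] G')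
    (g u w : G) : fderiv ℝ (fderiv ℝ (fun g => f (a + ℓ g))) g u w =
      fderiv ℝ (fderiv ℝ f) (a + ℓ g) (ℓ u) (ℓ w) := by
  have hF : ContDiff ℝ 2 (fun g => f (a + ℓ g)) :=
    hf.comp (contDiff_const.add ℓ.contDiff)
  have h1 := hasFDerivAt_fderiv_apply hF g w
  have h2 : HasFDerivAt (fun g => fderiv ℝ f (a + ℓ g) (ℓ w))
      (((ContinuousLinearMap.apply ℝ ℝ (ℓ w)).comp
        (fderiv ℝ (fderiv ℝ f) (a + ℓ g))).comp ℓ) g :=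
    HasFDerivAt.comp (g := fun z => fderiv ℝ f z (ℓ w)) (f := fun g => a + ℓ g) g
      (hasFDerivAt_fderiv_apply hf (a + ℓ g) (ℓ w)) (ℓ.hasFDerivAt.const_add a)
  simp only [fderiv_comp_affine hf] at h1
  have h3 := congrArg (fun M => M u) (h1.unique h2)
  simpa using h3

end Calculus

/-! ### The discrete action, its critical points and its coercivity. -/

section Action
variable {d : ℕ}

/-- The space of the `n` intermediate points of a discrete path. -/
abbrev Mid (n d : ℕ) : Type := PiLp 2 (fun _ : Fin n => E d)

/-- The discrete path with end points `x`, `y` and given intermediate points, as a linear function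
of these data; it is constant from time `n + 1` on. -/
def path (n d : ℕ) : ℕ → (E d × E d × Mid n d →L[ℝ] E d)
  | 0 => ContinuousLinearMap.fst ℝ _ _
  | j + 1 => if h : j < n then
      (PiLp.proj 2 (fun _ : Fin n => E d) ⟨j, h⟩).comp
        ((ContinuousLinearMap.snd ℝ _ _).comp (ContinuousLinearMap.snd ℝ _ _))
    else (ContinuousLinearMap.fst ℝ _ _).comp (ContinuousLinearMap.snd ℝ _ _)

/-- The `i`-th step of the discrete path. -/
def pathStep (n d i : ℕ) : E d × E d × Mid n d →L[ℝ] E d × E d :=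
  (path n d i).prod (path n d (i + 1))

@[simp] theorem path_zero {n : ℕ} (g : E d × E d × Mid n d) : path n d 0 g = g.1 := rfl

theorem path_succ {n j : ℕ} (h : j < n) (g : E d × E d × Mid n d) :
    path n d (j + 1) g = g.2.2 ⟨j, h⟩ := by
  simp [path, h]

@[simp] theorem path_last {n : ℕ} (g : E d × E d × Mid n d) : path n d (n + 1) g = g.2.1 := by
  simp [path]

@[simp] theorem pathStep_apply {n i : ℕ} (g : E d × E d × Mid n d) :
    pathStep n d i g = (path n d i g, path n d (i + 1) g) := rfl

/-- The intermediate points of a sequence. -/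
def mid (n : ℕ) (s : ℕ → E d) : Mid n d := WithLp.toLp 2 fun j => s (j + 1)

theorem path_mid {n : ℕ} (s : ℕ → E d) {i : ℕ} (hi : i ≤ n + 1) :
    path n d i (s 0, s (n + 1), mid n s) = s i := by
  rcases i with _ | j
  · rfl
  · rcases (Nat.succ_le_succ_iff.1 hi).lt_or_eq with h | rfl
    · rw [path_succ h]
      rfl
    · rw [path_last]

theorem mid_path {n : ℕ} (g : E d × E d × Mid n d) : mid n (fun i => path n d i g) = g.2.2 := by
  ext1 j
  exact path_succ j.2 g

/-- Summation by parts: each intermediate point collects one term from the step arriving there and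
one from the step leaving. It serves both the first and the second variation. -/
theorem sum_range_pair (n : ℕ) (a b : ℕ → StrongDual ℝ (E d)) (w : ℕ → E d) :
    ∑ i ∈ Finset.range (n + 1), (a i (w i) + b i (w (i + 1))) =
      a 0 (w 0) + ∑ j ∈ Finset.range n, (b j + a (j + 1)) (w (j + 1)) + b n (w (n + 1)) := by
  rw [Finset.sum_add_distrib, Finset.sum_range_succ' (fun i => a i (w i)),
    Finset.sum_range_succ (fun i => b i (w (i + 1)))]
  simp only [add_apply, Finset.sum_add_distrib]
  ring

/-- The action of a discrete path. -/
def action (S : E d × E d → ℝ) (n : ℕ) (g : E d × E d × Mid n d) : ℝ :=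
  ∑ i ∈ Finset.range (n + 1), S (pathStep n d i g)

variable {S : E d × E d → ℝ} {n : ℕ}

theorem action_contDiff (hS : IsGeneratingFunction S) : ContDiff ℝ 2 (action S n) :=
  ContDiff.sum fun i _ => hS.contDiff.comp (pathStep n d i).contDiff

theorem fderiv_fderiv_action (hS : IsGeneratingFunction S) (g u w : E d × E d × Mid n d) :
    fderiv ℝ (fderiv ℝ (action S n)) g u w =
      ∑ i ∈ Finset.range (n + 1),
        fderiv ℝ (fderiv ℝ S) (pathStep n d i g) (pathStep n d i u) (pathStep n d i w) :=
  fderiv_fderiv_sum_comp_clm hS.contDiff (pathStep n d) (n + 1) g u w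

theorem fderiv_action_apply (hS : IsGeneratingFunction S) (g w : E d × E d × Mid n d) :
    fderiv ℝ (action S n) g w =
      d₁ S g.1 (path n d 1 g) w.1 + ∑ j ∈ Finset.range n,
        (d₂ S (path n d j g) (path n d (j + 1) g) +
          d₁ S (path n d (j + 1) g) (path n d (j + 2) g)) (path n d (j + 1) w) +
      d₂ S (path n d n g) g.2.1 w.2.1 := by
  have h := sum_range_pair n (fun i => d₁ S (path n d i g) (path n d (i + 1) g))
    (fun i => d₂ S (path n d i g) (path n d (i + 1) g)) (fun i => path n d i w)
  simp only [path_zero, path_last, zero_add] at h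
  rw [← h]
  refine (fderiv_sum_comp_clm hS.contDiff (pathStep n d) (n + 1) g w).trans ?_
  refine Finset.sum_congr rfl fun i _ => ?_
  rw [hS.d₁_apply, hS.d₂_apply, ← map_add]
  simp

/-- The restriction of the action to the paths with given end points. -/
def fixedAction (S : E d × E d → ℝ) (n : ℕ) (x y : E d) (v : Mid n d) : ℝ := action S n (x, y, v)

/-- A variation of the intermediate points. -/
def midVar (n d : ℕ) : Mid n d →L[ℝ] E d × E d × Mid n d :=
  (ContinuousLinearMap.inr ℝ (E d) (E d × Mid n d)).comp
    (ContinuousLinearMap.inr ℝ (E d) (Mid n d))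

@[simp] theorem midVar_apply {n : ℕ} (w : Mid n d) : midVar n d w = (0, 0, w) := rfl

theorem fixedAction_eq (S : E d × E d → ℝ) (n : ℕ) (x y : E d) :
    fixedAction S n x y = fun v => action S n ((x, y, 0) + midVar n d v) := by
  funext v
  simp [fixedAction]

/-- The discrete Euler-Lagrange equations for the first `n + 1` steps of a sequence. -/
def IsStationary (S : E d × E d → ℝ) (n : ℕ) (s : ℕ → E d) : Prop :=
  ∀ j < n, d₂ S (s j) (s (j + 1)) + d₁ S (s (j + 1)) (s (j + 2)) = 0

theorem fixedAction_contDiff (hS : IsGeneratingFunction S) (x y : E d) : ContDiff ℝ 2 (fixedAction S n x y) :=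
  (action_contDiff hS).comp (by fun_prop : ContDiff ℝ 2 fun v : Mid n d => (x, y, v))

theorem fderiv_fixedAction (hS : IsGeneratingFunction S) (x y : E d) (v w : Mid n d) :
    fderiv ℝ (fixedAction S n x y) v w = fderiv ℝ (action S n) (x, y, v) (0, 0, w) := by
  rw [fixedAction_eq, fderiv_comp_affine (action_contDiff hS)]
  simp

theorem fderiv_fderiv_fixedAction (hS : IsGeneratingFunction S) (x y : E d) (v u w : Mid n d) :
    fderiv ℝ (fderiv ℝ (fixedAction S n x y)) v u w =
      fderiv ℝ (fderiv ℝ (action S n)) (x, y, v) (0, 0, u) (0, 0, w) := by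
  rw [fixedAction_eq, fderiv_fderiv_comp_affine (action_contDiff hS)]
  simp

theorem fderiv_fixedAction_eq_zero_iff (hS : IsGeneratingFunction S) (x y : E d) (v : Mid n d) :
    fderiv ℝ (fixedAction S n x y) v = 0 ↔
      IsStationary S n (fun i => path n d i (x, y, v)) := by
  have key : ∀ w, fderiv ℝ (fixedAction S n x y) v w = ∑ j ∈ Finset.range n,
        (d₂ S (path n d j (x, y, v)) (path n d (j + 1) (x, y, v)) +
          d₁ S (path n d (j + 1) (x, y, v)) (path n d (j + 2) (x, y, v)))
            (path n d (j + 1) (0, 0, w)) := by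
    intro w
    rw [fderiv_fixedAction hS, fderiv_action_apply hS]
    simp
  constructor
  · intro h j hj
    ext1 e
    -- A variation supported at the single time `j + 1` isolates one Euler-Lagrange equation.
    have h1 := key (WithLp.toLp 2 (Pi.single ⟨j, hj⟩ e))
    rw [h, Finset.sum_eq_single_of_mem j (Finset.mem_range.2 hj)] at h1
    · rw [path_succ hj (0, 0, _)] at h1
      simpa using h1.symm
    · intro i hi hij
      rw [path_succ (Finset.mem_range.1 hi) (0, 0, _)]
      simp [hij]
  · intro h
    ext1 w
    rw [key w]
    refine Finset.sum_eq_zero fun j hj => ?_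
    have := h j (Finset.mem_range.1 hj)
    dsimp only at this
    rw [this]
    simp

theorem exists_norm_path_sub_le (hS : IsGeneratingFunction S) : ∃ β : ℝ, ∀ (g : E d × E d × Mid n d) (i : ℕ), i ≤ n + 1 →
    ‖path n d i g - g.1‖ ≤ action S n g + β := by
  obtain ⟨β, hβ0, hβ⟩ := hS.exists_norm_sub_le
  refine ⟨(n + 1) * β, fun g i hi => ?_⟩
  have h1 : ∀ i, ‖path n d i g - g.1‖ ≤
      ∑ j ∈ Finset.range i, ‖path n d (j + 1) g - path n d j g‖ := by
    intro i
    rw [← path_zero g, ← Finset.sum_range_sub (fun j => path n d j g)]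
    exact norm_sum_le _ _
  have h2 : ∑ j ∈ Finset.range i, ‖path n d (j + 1) g - path n d j g‖ ≤
      ∑ j ∈ Finset.range (n + 1), ‖path n d (j + 1) g - path n d j g‖ :=
    Finset.sum_le_sum_of_subset_of_nonneg (Finset.range_mono hi) fun _ _ _ => norm_nonneg _
  have h3 : ∑ j ∈ Finset.range (n + 1), (‖path n d (j + 1) g - path n d j g‖ - β) ≤
      action S n g := Finset.sum_le_sum fun j _ => hβ _ _
  rw [Finset.sum_sub_distrib, Finset.sum_const, Finset.card_range, nsmul_eq_mul] at h3
  push_cast at h3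
  linarith [h1 i]

theorem norm_le_of_forall_norm_le {v : Mid n d} {R : ℝ} (h : ∀ j, ‖v j‖ ≤ R) :
    ‖v‖ ≤ Real.sqrt (n * R ^ 2) := by
  refine Real.le_sqrt_of_sq_le ?_
  rw [PiLp.norm_sq_eq_of_L2]
  calc ∑ j, ‖v j‖ ^ 2 ≤ ∑ _j : Fin n, R ^ 2 :=
        Finset.sum_le_sum fun j _ => pow_le_pow_left₀ (norm_nonneg _) (h j) 2
    _ = n * R ^ 2 := by simp

/-- Linear growth of `S` bounds every step by the action. Uniformity in the end points is needed to
extract limits of minimizers whose end points move. -/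
theorem exists_forall_norm_le (hS : IsGeneratingFunction S) (c r : ℝ) : ∃ R : ℝ, ∀ (x y : E d) (v : Mid n d), ‖x‖ ≤ r →
    fixedAction S n x y v ≤ c → ‖v‖ ≤ R := by
  obtain ⟨β, hβ⟩ := exists_norm_path_sub_le hS (n := n)
  refine ⟨_, fun x y v hx hv => norm_le_of_forall_norm_le (R := r + (c + β)) fun j => ?_⟩
  have h1 := hβ (x, y, v) (j + 1) (by omega)
  rw [path_succ j.2] at h1
  change ‖v j - x‖ ≤ fixedAction S n x y v + β at h1
  calc ‖v j‖ = ‖x + (v j - x)‖ := by rw [add_sub_cancel]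
    _ ≤ ‖x‖ + ‖v j - x‖ := norm_add_le _ _
    _ ≤ r + (c + β) := by linarith

theorem isCompact_fixedAction_le (hS : IsGeneratingFunction S) (x y : E d) (c : ℝ) :
    IsCompact {v | fixedAction S n x y v ≤ c} := by
  obtain ⟨R, hR⟩ := exists_forall_norm_le hS (n := n) c ‖x‖
  refine (isCompact_closedBall (0 : Mid n d) R).of_isClosed_subset
    (isClosed_le (fixedAction_contDiff hS x y).continuous continuous_const) fun v hv => ?_
  rw [mem_closedBall_zero_iff]
  exact hR x y v le_rfl hv

theorem exists_forall_fixedAction_le (hS : IsGeneratingFunction S) (x y : E d) :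
    ∃ v : Mid n d, ∀ w, fixedAction S n x y v ≤ fixedAction S n x y w := by
  obtain ⟨v, hv, hmin⟩ := (isCompact_fixedAction_le hS x y
    (fixedAction S n x y (0 : Mid n d))).exists_isMinOn ⟨0, le_refl (fixedAction S n x y 0)⟩
    (fixedAction_contDiff hS x y).continuous.continuousOn
  refine ⟨v, fun w => ?_⟩
  by_cases hw : fixedAction S n x y w ≤ fixedAction S n x y (0 : Mid n d)
  · exact hmin hw
  · exact le_trans hv (not_le.1 hw).le

theorem fderiv_fixedAction_eq_zero_of_forall_le {x y : E d} {v : Mid n d}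
    (h : ∀ w, fixedAction S n x y v ≤ fixedAction S n x y w) :
    fderiv ℝ (fixedAction S n x y) v = 0 :=
  IsLocalMin.fderiv_eq_zero (Filter.Eventually.of_forall h)

end Action

/-! ### Orbits as critical paths, and their minimality without conjugate points. -/

section Dynamics
variable {d : ℕ} {S : E d × E d → ℝ} {Φ : Cot d → Cot d} {n : ℕ}

theorem iterate_of_isStationary (hΦ : IsGeneratedBy Φ S) {s : ℕ → E d}
    (hs : IsStationary S n s) {i : ℕ} (hi : i ≤ n) :
    Φ^[i] (s 0, -d₁ S (s 0) (s 1)) = (s i, -d₁ S (s i) (s (i + 1))) := by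
  induction i with
  | zero => rfl
  | succ i ih =>
    rw [Function.iterate_succ_apply', ih (by omega), hΦ.apply_eq,
      eq_neg_of_add_eq_zero_left (hs i (by omega))]

theorem iterate_succ_of_isStationary (hΦ : IsGeneratedBy Φ S) {s : ℕ → E d}
    (hs : IsStationary S n s) :
    Φ^[n + 1] (s 0, -d₁ S (s 0) (s 1)) = (s (n + 1), d₂ S (s n) (s (n + 1))) := by
  rw [Function.iterate_succ_apply', iterate_of_isStationary hΦ hs le_rfl, hΦ.apply_eq]

/-- The projection to the configuration space of an orbit. -/
def orbit (Φ : Cot d → Cot d) (z : Cot d) (i : ℕ) : E d := (Φ^[i] z).1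

theorem iterate_eq_orbit (hΦ : IsGeneratedBy Φ S) (z : Cot d) (i : ℕ) :
    Φ^[i] z = (orbit Φ z i, -d₁ S (orbit Φ z i) (orbit Φ z (i + 1))) := by
  have h := hΦ.snd_eq (Φ^[i] z)
  rw [← Function.iterate_succ_apply' Φ i z] at h
  exact Prod.ext rfl h

theorem isStationary_orbit (hΦ : IsGeneratedBy Φ S) (z : Cot d) :
    IsStationary S n (orbit Φ z) := by
  intro j _
  have h1 := iterate_eq_orbit hΦ z (j + 1)
  rw [Function.iterate_succ_apply', iterate_eq_orbit hΦ z j, hΦ.apply_eq] at h1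
  have h2 := (Prod.ext_iff.1 h1).2
  dsimp only at h2
  rw [h2]
  exact neg_add_cancel _

/-- The absence of conjugate points, for a map of `T*ℝ^d`. -/
structure HasNoConjugatePoints (Φ : Cot d → Cot d) : Prop where
  differentiable : Differentiable ℝ Φ
  transverse : ∀ (N : ℕ), 1 ≤ N → ∀ (z : Cot d) (η : StrongDual ℝ (E d)),
    (fderiv ℝ Φ^[N] z (0, η)).1 = 0 → fderiv ℝ Φ^[N] z (0, η) = 0

theorem fderiv_iterate_succ (hd : Differentiable ℝ Φ) (i : ℕ) (z ζ : Cot d) :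
    fderiv ℝ Φ^[i + 1] z ζ = fderiv ℝ Φ (Φ^[i] z) (fderiv ℝ Φ^[i] z ζ) := by
  have h : HasFDerivAt Φ^[i + 1] ((fderiv ℝ Φ (Φ^[i] z)).comp (fderiv ℝ Φ^[i] z)) z := by
    rw [Function.iterate_succ']
    exact (hd _).hasFDerivAt.comp z ((hd.iterate i) z).hasFDerivAt
  rw [h.fderiv]
  rfl

theorem eq_zero_of_fderiv_iterate_eq_zero (hΦ : IsGeneratedBy Φ S)
    (hS : IsGeneratingFunction S) (hd : Differentiable ℝ Φ) (i : ℕ) {z ζ : Cot d}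
    (h : fderiv ℝ Φ^[i] z ζ = 0) : ζ = 0 := by
  induction i with
  | zero => simpa using h
  | succ i ih =>
    rw [fderiv_iterate_succ hd] at h
    exact ih (hΦ.eq_zero_of_hasFDerivAt hS (hd _).hasFDerivAt h)

/-- A discrete Jacobi field is the image of an initial vector by the differentials of the
iterates. -/
theorem fderiv_iterate_eq_of_jacobi (hΦ : IsGeneratedBy Φ S) (hS : IsGeneratingFunction S)
    (hd : Differentiable ℝ Φ) (z : Cot d) (ζ : ℕ → Cot d) (N : ℕ)
    (h₁ : ∀ j < N, ∀ e, (ζ j).2 e = -fderiv ℝ (fderiv ℝ S) (orbit Φ z j, orbit Φ z (j + 1))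
      ((ζ j).1, (ζ (j + 1)).1) (e, 0))
    (h₂ : ∀ j < N, ∀ e, (ζ (j + 1)).2 e =
      fderiv ℝ (fderiv ℝ S) (orbit Φ z j, orbit Φ z (j + 1))
      ((ζ j).1, (ζ (j + 1)).1) (0, e)) {i : ℕ} (hi : i ≤ N) :
    fderiv ℝ Φ^[i] z (ζ 0) = ζ i := by
  induction i with
  | zero => simp
  | succ i ih =>
    rw [fderiv_iterate_succ hd, ih (by omega)]
    have horb : ((Φ^[i] z).1, (Φ (Φ^[i] z)).1) = (orbit Φ z i, orbit Φ z (i + 1)) := by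
      rw [orbit, orbit, Function.iterate_succ_apply']
    refine hΦ.eq_of_hasFDerivAt hS (hd _).hasFDerivAt _ _ (fun w => ?_) (fun w => ?_)
    · rw [horb]
      exact h₁ i (by omega) w
    · rw [horb]
      exact h₂ i (by omega) w

/-- Without conjugate points, a discrete Jacobi field vanishing at both ends vanishes. -/
theorem jacobi_eq_zero (hΦ : IsGeneratedBy Φ S) (hS : IsGeneratingFunction S)
    (hc : HasNoConjugatePoints Φ) (z : Cot d) (w : ℕ → E d) (hw0 : w 0 = 0)
    (hwn : w (n + 1) = 0)
    (hw : ∀ j < n, ∀ e,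
      fderiv ℝ (fderiv ℝ S) (orbit Φ z j, orbit Φ z (j + 1)) (w j, w (j + 1)) (0, e) +
      fderiv ℝ (fderiv ℝ S) (orbit Φ z (j + 1), orbit Φ z (j + 2)) (w (j + 1), w (j + 2)) (e, 0)
        = 0) {i : ℕ} (hi : i ≤ n + 1) : w i = 0 := by
  let D : ℕ → StrongDual ℝ (E d × E d) := fun j =>
    fderiv ℝ (fderiv ℝ S) (orbit Φ z j, orbit Φ z (j + 1)) (w j, w (j + 1))
  -- Momenta dictated by the linearized equations. At intermediate times the arriving and the
  -- leaving step each prescribe one, and `hw` says that they agree.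
  let η : ℕ → StrongDual ℝ (E d)
    | 0 => -(D 0).comp (ContinuousLinearMap.inl ℝ (E d) (E d))
    | j + 1 => (D j).comp (ContinuousLinearMap.inr ℝ (E d) (E d))
  have key : ∀ i ≤ n + 1, fderiv ℝ Φ^[i] z (w 0, η 0) = (w i, η i) := fun i hi =>
    fderiv_iterate_eq_of_jacobi hΦ hS hc.differentiable z (fun j => (w j, η j)) (n + 1) (by
      rintro (_ | j) hj e
      · simp [η, D]
      · have h := hw j (by omega) e
        simp only [η, D, ContinuousLinearMap.comp_apply, ContinuousLinearMap.inr_apply]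
        linarith) (by
      intro j hj e
      simp [η, D]) (i := i) hi
  rw [hw0] at key
  -- The field starts vertical and is vertical again at time `n + 1`, so its final value vanishes;
  -- injectivity of the differential carries this back to time `0`.
  have h1 := hc.transverse (n + 1) (by omega) z (η 0) (by rw [key _ le_rfl, hwn])
  have h2 := eq_zero_of_fderiv_iterate_eq_zero hΦ hS hc.differentiable _ h1
  have h3 := key i hi
  rw [h2, map_zero] at h3
  exact (congrArg Prod.fst h3).symm

theorem path_orbit (z : Cot d) {i : ℕ} (hi : i ≤ n + 1) :
    path n d i (z.1, orbit Φ z (n + 1), mid n (orbit Φ z)) = orbit Φ z i :=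
  path_mid (orbit Φ z) hi

/-- Testing a kernel vector against variations at a single time gives the Jacobi equation; its two
end values are zero because the end points are fixed. -/
theorem hessian_fixedAction_nondegenerate (hΦ : IsGeneratedBy Φ S)
    (hS : IsGeneratingFunction S) (hc : HasNoConjugatePoints Φ) (z : Cot d) (u : Mid n d)
    (hu : ∀ w, fderiv ℝ (fderiv ℝ (fixedAction S n z.1 (orbit Φ z (n + 1))))
      (mid n (orbit Φ z)) u w = 0) : u = 0 := by
  have hzero : ∀ i ≤ n + 1, path n d i (0, 0, u) = 0 := by
    intro i hi
    refine jacobi_eq_zero hΦ hS hc z (fun i => path n d i (0, 0, u)) (by simp) (by simp) ?_ hi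
    intro j hj e
    have h := hu (WithLp.toLp 2 (Pi.single ⟨j, hj⟩ e))
    let D : ℕ → StrongDual ℝ (E d × E d) := fun j =>
      fderiv ℝ (fderiv ℝ S) (orbit Φ z j, orbit Φ z (j + 1))
        (path n d j (0, 0, u), path n d (j + 1) (0, 0, u))
    rw [fderiv_fderiv_fixedAction hS, fderiv_fderiv_action hS] at h
    have h2 := sum_range_pair n (fun i => (D i).comp (ContinuousLinearMap.inl ℝ (E d) (E d)))
      (fun i => (D i).comp (ContinuousLinearMap.inr ℝ (E d) (E d)))
      (fun i => path n d i (0, 0, WithLp.toLp 2 (Pi.single ⟨j, hj⟩ e)))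
    rw [Finset.sum_congr rfl (g := fun i => ((D i).comp (ContinuousLinearMap.inl ℝ (E d) (E d)))
      (path n d i (0, 0, WithLp.toLp 2 (Pi.single ⟨j, hj⟩ e))) +
      ((D i).comp (ContinuousLinearMap.inr ℝ (E d) (E d)))
        (path n d (i + 1) (0, 0, WithLp.toLp 2 (Pi.single ⟨j, hj⟩ e)))), h2,
      Finset.sum_eq_single_of_mem j (Finset.mem_range.2 hj)] at h
    · rw [path_succ hj (0, 0, _)] at h
      simp only [path_zero, path_last, map_zero, zero_add, add_zero] at h
      simpa [D] using h
    · intro i hi hij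
      have h0 : path n d (i + 1) (0, 0, WithLp.toLp 2 (Pi.single ⟨j, hj⟩ e)) = 0 := by
        rw [path_succ (Finset.mem_range.1 hi) (0, 0, _)]
        simp [hij]
      rw [h0, map_zero]
    · intro i hi
      have hi' := Finset.mem_range.1 hi
      rw [pathStep_apply, pathStep_apply, pathStep_apply, path_orbit z (by omega),
        path_orbit z (by omega), ContinuousLinearMap.comp_apply, ContinuousLinearMap.comp_apply,
        ← map_add]
      simp [D]
  ext1 j
  rw [← path_succ j.2 (0, 0, u)]
  exact hzero _ (by omega)

theorem continuous_orbit (hcont : Continuous Φ) (i : ℕ) : Continuous fun z => orbit Φ z i :=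
  continuous_fst.comp (hcont.iterate i)

/-- The intermediate points of a critical path are those of an orbit. -/
theorem eq_orbit_of_fderiv_eq_zero (hΦ : IsGeneratedBy Φ S) (hS : IsGeneratingFunction S)
    {x y : E d} {v : Mid n d} (hv : fderiv ℝ (fixedAction S n x y) v = 0) :
    ∃ p, orbit Φ (x, p) (n + 1) = y ∧ mid n (orbit Φ (x, p)) = v := by
  have hst := (fderiv_fixedAction_eq_zero_iff hS x y v).1 hv
  have h0 := fun i hi => congrArg Prod.fst (iterate_of_isStationary hΦ hst (i := i) hi)
  have h1 := congrArg Prod.fst (iterate_succ_of_isStationary hΦ hst)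
  refine ⟨_, h1.trans (path_last _), ?_⟩
  refine Eq.trans ?_ (mid_path (x, y, v))
  ext1 j
  exact h0 (j + 1) j.2

/-- Keep `x` but let the final point vary: all critical paths from `x` then form one family indexed
by the vector space of momenta. It contains a minimizer from `x` to `x`, whose Hessian is
semidefinite, and definiteness spreads from there. -/
theorem hessian_fixedAction_pos_def (hΦ : IsGeneratedBy Φ S) (hS : IsGeneratingFunction S)
    (hc : HasNoConjugatePoints Φ) {x y : E d} {v : Mid n d}
    (hv : fderiv ℝ (fixedAction S n x y) v = 0) (w : Mid n d) (hw : w ≠ 0) :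
    0 < fderiv ℝ (fderiv ℝ (fixedAction S n x y)) v w w := by
  have hcont := hc.differentiable.continuous
  have hmid : Continuous fun p : StrongDual ℝ (E d) => mid n (orbit Φ (x, p)) :=
    (PiLp.continuous_toLp 2 _).comp (continuous_pi fun j =>
      (continuous_orbit hcont (j + 1)).comp (by fun_prop))
  have hg : Continuous fun p : StrongDual ℝ (E d) =>
      (x, orbit Φ (x, p) (n + 1), mid n (orbit Φ (x, p))) :=
    continuous_const.prodMk (((continuous_orbit hcont (n + 1)).comp (by fun_prop)).prodMk hmid)
  have hD : Continuous (fderiv ℝ (fderiv ℝ (action S n))) :=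
    ((action_contDiff hS).fderiv_right (m := 1) (by norm_num)).continuous_fderiv (by norm_num)
  -- The final point moves with `p`, so the form is read off the Hessian of the unrestricted action,
  -- where continuity in `p` is visible.
  let B : StrongDual ℝ (E d) → Mid n d →L[ℝ] Mid n d →L[ℝ] ℝ := fun p =>
    ((ContinuousLinearMap.compL ℝ (Mid n d) (E d × E d × Mid n d) ℝ).flip (midVar n d)).comp
      ((fderiv ℝ (fderiv ℝ (action S n))
        (x, orbit Φ (x, p) (n + 1), mid n (orbit Φ (x, p)))).comp (midVar n d))
  have hB : ∀ p u w, B p u w = fderiv ℝ (fderiv ℝ (fixedAction S n x (orbit Φ (x, p) (n + 1))))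
      (mid n (orbit Φ (x, p))) u w := fun p u w => by
    rw [fderiv_fderiv_fixedAction hS]
    rfl
  have hBcont : Continuous B :=
    continuous_const.clm_comp ((hD.comp hg).clm_comp continuous_const)
  obtain ⟨v₀, hv₀⟩ := exists_forall_fixedAction_le hS (n := n) x x
  obtain ⟨p₀, hy₀, hp₀⟩ := eq_orbit_of_fderiv_eq_zero hΦ hS
    (fderiv_fixedAction_eq_zero_of_forall_le hv₀)
  obtain ⟨p, hy, hp⟩ := eq_orbit_of_fderiv_eq_zero hΦ hS hv
  have h := pos_def_of_preconnected_family B hBcont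
    (fun p u w => by
      rw [hB, hB]
      exact ((fixedAction_contDiff hS _ _).contDiffAt.isSymmSndFDerivAt (by simp)).eq u w)
    (fun p u hu => hessian_fixedAction_nondegenerate hΦ hS hc (x, p) u
      fun w => (hB p u w).symm.trans (hu w)) p₀
    (fun w => by
      rw [hB, hy₀, hp₀]
      exact hessian_nonneg_of_forall_le (fixedAction_contDiff hS x x) hv₀ w) p w hw
  rwa [hB, hy, hp] at h

/-- Without conjugate points, two points are joined by at most one path of given length
satisfying the discrete Euler-Lagrange equations. -/
theorem eq_of_fderiv_fixedAction_eq_zero (hΦ : IsGeneratedBy Φ S) (hS : IsGeneratingFunction S)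
    (hc : HasNoConjugatePoints Φ) {x y : E d} {v v' : Mid n d}
    (hv : fderiv ℝ (fixedAction S n x y) v = 0) (hv' : fderiv ℝ (fixedAction S n x y) v' = 0) :
    v = v' :=
  eq_of_fderiv_eq_zero_of_pos_def_hessian (fixedAction_contDiff hS x y)
    (isCompact_fixedAction_le hS x y)
    (fun _ hz => hessian_fixedAction_pos_def hΦ hS hc hz) hv hv'

/-- A minimizer exists and is critical, so the uniqueness of critical points identifies it with the
given sequence. -/
theorem forall_fixedAction_le_of_isStationary (hΦ : IsGeneratedBy Φ S)
    (hS : IsGeneratingFunction S) (hc : HasNoConjugatePoints Φ) {s : ℕ → E d}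
    (hs : IsStationary S n s) (w : Mid n d) :
    fixedAction S n (s 0) (s (n + 1)) (mid n s) ≤ fixedAction S n (s 0) (s (n + 1)) w := by
  obtain ⟨v, hv⟩ := exists_forall_fixedAction_le hS (n := n) (s 0) (s (n + 1))
  have hcrit : fderiv ℝ (fixedAction S n (s 0) (s (n + 1))) (mid n s) = 0 := by
    rw [fderiv_fixedAction_eq_zero_iff hS]
    intro j hj
    dsimp only
    rw [path_mid s (by omega), path_mid s (by omega), path_mid s (by omega)]
    exact hs j hj
  rw [eq_of_fderiv_fixedAction_eq_zero hΦ hS hc hcrit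
    (fderiv_fixedAction_eq_zero_of_forall_le hv)]
  exact hv w

theorem action_mid (s : ℕ → E d) :
    fixedAction S n (s 0) (s (n + 1)) (mid n s) =
      ∑ i ∈ Finset.range (n + 1), S (s i, s (i + 1)) := by
  unfold fixedAction action
  refine Finset.sum_congr rfl fun i hi => ?_
  have hi' := Finset.mem_range.1 hi
  rw [pathStep_apply, path_mid s (by omega), path_mid s (by omega)]

/-- Without conjugate points, a sequence satisfying the discrete Euler-Lagrange equations
minimizes the action among sequences with the same end points. -/
theorem sum_le_sum_of_isStationary (hΦ : IsGeneratedBy Φ S)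
    (hS : IsGeneratingFunction S) (hc : HasNoConjugatePoints Φ) {s t : ℕ → E d}
    (hs : IsStationary S n s) (h0 : t 0 = s 0) (hn : t (n + 1) = s (n + 1)) :
    ∑ i ∈ Finset.range (n + 1), S (s i, s (i + 1)) ≤
      ∑ i ∈ Finset.range (n + 1), S (t i, t (i + 1)) := by
  rw [← action_mid, ← action_mid, h0, hn]
  exact forall_fixedAction_le_of_isStationary hΦ hS hc hs _

/-- Two such orbits are critical for the same action, hence share their first step, which determines
the initial momentum. -/
theorem orbit_fst_injective (hΦ : IsGeneratedBy Φ S)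
    (hS : IsGeneratingFunction S) (hc : HasNoConjugatePoints Φ) (x : E d) :
    Function.Injective fun p => orbit Φ (x, p) (n + 1) := by
  intro p q h
  dsimp only at h
  have hcrit : ∀ p, fderiv ℝ (fixedAction S n x (orbit Φ (x, p) (n + 1)))
      (mid n (orbit Φ (x, p))) = 0 := by
    intro p
    rw [fderiv_fixedAction_eq_zero_iff hS]
    intro j hj
    have h1 := fun i hi => path_orbit (Φ := Φ) (n := n) (x, p) (i := i) hi
    dsimp only at h1 ⊢
    rw [h1 _ (by omega), h1 _ (by omega), h1 _ (by omega)]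
    exact isStationary_orbit hΦ (n := n) (x, p) j hj
  have h1 := hcrit q
  rw [← h] at h1
  have hmid := eq_of_fderiv_fixedAction_eq_zero hΦ hS hc (hcrit p) h1
  have horb : orbit Φ (x, p) 1 = orbit Φ (x, q) 1 := by
    rw [← path_orbit (n := n) (x, p) (by omega), ← path_orbit (n := n) (x, q) (by omega), ← h,
      hmid]
  have h2 := congrArg Prod.snd (iterate_eq_orbit hΦ (x, p) 0)
  have h3 := congrArg Prod.snd (iterate_eq_orbit hΦ (x, q) 0)
  have h4 : p = -d₁ S x (orbit Φ (x, p) 1) := h2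
  have h5 : q = -d₁ S x (orbit Φ (x, q) 1) := h3
  rw [h4, h5, horb]

end Dynamics

/-! ### Integer translations and periodic extension of sequences. -/

section IntVec
variable {d : ℕ}

theorem intVec_add (r s : Fin d → ℤ) : intVec (r + s) = intVec r + intVec s := by
  ext i
  simp [intVec_apply]

@[simp] theorem intVec_zero : intVec (0 : Fin d → ℤ) = 0 := by
  ext i
  simp [intVec_apply]

theorem intVec_neg (r : Fin d → ℤ) : intVec (-r) = -intVec r := by
  ext i
  simp [intVec_apply]

end IntVec

section PeriodicExtension
variable {d : ℕ} {n : ℕ} {r : Fin d → ℤ} {s : ℕ → E d} {S : E d × E d → ℝ}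

/-- The extension of the first terms of a sequence to a sequence which is periodic up to an
integer translation. -/
def periodicExt (n : ℕ) (r : Fin d → ℤ) (s : ℕ → E d) (i : ℕ) : E d :=
  s (i % (n + 1)) + intVec ((i / (n + 1)) • r)

theorem mod_succ_cases (n i : ℕ) :
    (i % (n + 1) < n ∧ (i + 1) % (n + 1) = i % (n + 1) + 1 ∧ (i + 1) / (n + 1) = i / (n + 1)) ∨
    (i % (n + 1) = n ∧ (i + 1) % (n + 1) = 0 ∧ (i + 1) / (n + 1) = i / (n + 1) + 1) := by
  obtain ⟨q, m, hm, rfl⟩ : ∃ q m, m < n + 1 ∧ i = (n + 1) * q + m :=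
    ⟨i / (n + 1), i % (n + 1), Nat.mod_lt i (Nat.succ_pos n), (Nat.div_add_mod i (n + 1)).symm⟩
  have e1 : ((n + 1) * q + m) % (n + 1) = m := by
    rw [Nat.mul_add_mod, Nat.mod_eq_of_lt hm]
  have e2 : ((n + 1) * q + m) / (n + 1) = q := by
    rw [Nat.mul_add_div (by omega), Nat.div_eq_of_lt hm, add_zero]
  rw [e1, e2]
  rcases (Nat.lt_succ_iff.1 hm).lt_or_eq with h | rfl
  · refine Or.inl ⟨h, ?_, ?_⟩
    · rw [add_assoc, Nat.mul_add_mod, Nat.mod_eq_of_lt (by omega)]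
    · rw [add_assoc, Nat.mul_add_div (by omega), Nat.div_eq_of_lt (by omega), add_zero]
  · have h3 : (m + 1) * q + m + 1 = (m + 1) * (q + 1) := by ring
    refine Or.inr ⟨rfl, ?_, ?_⟩
    · rw [h3, Nat.mul_mod_right]
    · rw [h3, Nat.mul_div_cancel_left _ (by omega)]

theorem periodicExt_succ (hs : s (n + 1) = s 0 + intVec r) (i : ℕ) :
    periodicExt n r s (i + 1) = s (i % (n + 1) + 1) + intVec ((i / (n + 1)) • r) := by
  rw [periodicExt]
  rcases mod_succ_cases n i with ⟨-, h2, h3⟩ | ⟨h1, h2, h3⟩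
  · rw [h2, h3]
  · rw [h2, h3, h1, hs, succ_nsmul', intVec_add, add_assoc]

theorem apply_periodicExt (hS : IsGeneratingFunction S) (hs : s (n + 1) = s 0 + intVec r)
    (i : ℕ) : S (periodicExt n r s i, periodicExt n r s (i + 1)) =
      S (s (i % (n + 1)), s (i % (n + 1) + 1)) := by
  rw [periodicExt_succ hs, periodicExt, hS.periodic]

theorem sum_periodicExt (hS : IsGeneratingFunction S) (hs : s (n + 1) = s 0 + intVec r) (k : ℕ) :
    ∑ i ∈ Finset.range (k * (n + 1)), S (periodicExt n r s i, periodicExt n r s (i + 1)) =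
      k * ∑ i ∈ Finset.range (n + 1), S (s i, s (i + 1)) := by
  simp only [apply_periodicExt hS hs]
  induction k with
  | zero => simp
  | succ k ih =>
    rw [add_mul, one_mul, Finset.sum_range_add, ih, Nat.cast_succ, add_mul, one_mul]
    congr 1
    refine Finset.sum_congr rfl fun j hj => ?_
    rw [Nat.mul_add_mod', Nat.mod_eq_of_lt (Finset.mem_range.1 hj)]

/-- Within a period these are the translated equations of `s`; at a seam the missing equation is
exactly the equality of momenta `hcl`. -/
theorem isStationary_periodicExt (hS : IsGeneratingFunction S)
    (hs : s (n + 1) = s 0 + intVec r) (hst : IsStationary S n s)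
    (hcl : d₂ S (s n) (s (n + 1)) + d₁ S (s 0) (s 1) = 0) (m : ℕ) :
    IsStationary S m (periodicExt n r s) := by
  intro j _
  rw [periodicExt_succ hs (j + 1), periodicExt_succ hs j]
  -- The term `d₂` is read in the period of `j`, the term `d₁` in that of `j + 1`; they differ at a
  -- seam.
  nth_rewrite 2 [← periodicExt_succ hs j]
  rw [periodicExt, periodicExt, hS.d₁_add_intVec, hS.d₂_add_intVec]
  rcases mod_succ_cases n j with ⟨h1, h2, -⟩ | ⟨h1, h2, -⟩
  · rw [h2]
    exact hst _ h1
  · rw [h2, h1]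
    exact hcl

theorem periodicExt_zero : periodicExt n r s 0 = s 0 := by simp [periodicExt]

theorem periodicExt_mul (k : ℕ) : periodicExt n r s (k * (n + 1)) = s 0 + intVec (k • r) := by
  rw [periodicExt, Nat.mul_mod_left, Nat.mul_div_cancel _ (by omega)]

end PeriodicExtension

/-! ### Constancy of the minimal action from `x` to `x + r`. -/

section Minimizers
variable {d : ℕ} {S : E d × E d → ℝ} {Φ : Cot d → Cot d} {n : ℕ}

/-- At a maximum of `x ↦ min S(x, …, x + ρ)`, the action of the minimizer does not increase to
first order when both end points are translated. -/
theorem fderiv_action_diag_le_of_isMax (hΦ : IsGeneratedBy Φ S) (hS : IsGeneratingFunction S)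
    (hc : HasNoConjugatePoints Φ) (ρ : E d) (c : E d → Mid n d)
    (hmin : ∀ x w, fixedAction S n x (x + ρ) (c x) ≤ fixedAction S n x (x + ρ) w) (x₀ : E d)
    (hmax : ∀ x, fixedAction S n x (x + ρ) (c x) ≤ fixedAction S n x₀ (x₀ + ρ) (c x₀))
    (u : E d) : fderiv ℝ (action S n) (x₀, x₀ + ρ, c x₀) (u, u, 0) ≤ 0 := by
  have hF := action_contDiff hS (n := n)
  let t : ℕ → ℝ := fun k => 1 / ((k : ℝ) + 1)
  have ht0 : ∀ k, 0 < t k := fun k => by positivity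
  have ht1 : ∀ k, t k ≤ 1 := fun k => by
    rw [div_le_one (by positivity)]
    linarith [(Nat.cast_nonneg k : (0 : ℝ) ≤ k)]
  have htlim : Filter.Tendsto t Filter.atTop (𝓝 0) := tendsto_one_div_add_atTop_nhds_zero_nat
  let X : ℝ → E d := fun τ => x₀ + τ • u
  have hX : Continuous X := by fun_prop
  have hX0 : X 0 = x₀ := by simp [X]
  have hderiv : ∀ (v : Mid n d) (τ : ℝ), HasDerivAt (fun τ => action S n (X τ, X τ + ρ, v))
      (fderiv ℝ (action S n) (X τ, X τ + ρ, v) (u, u, 0)) τ := by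
    intro v τ
    have h1 : HasDerivAt X u τ := by
      change HasDerivAt (fun τ => x₀ + τ • u) u τ
      simpa using ((hasDerivAt_id τ).smul_const u).const_add x₀
    exact (hF.differentiable (by norm_num) _).hasFDerivAt.comp_hasDerivAt τ
      (h1.prodMk ((h1.add_const ρ).prodMk (hasDerivAt_const τ v)))
  -- The minimizer at `X (t k)` is a competitor at `x₀`, so with these intermediate points frozen
  -- the action at `x₀` is at least that at `X (t k)`.
  have hstep : ∀ k, ∃ θ : ℝ, 0 < θ ∧ θ < t k ∧
      fderiv ℝ (action S n) (X θ, X θ + ρ, c (X (t k))) (u, u, 0) ≤ 0 := by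
    intro k
    obtain ⟨θ, hθ, hθeq⟩ := exists_hasDerivAt_eq_slope _ _ (ht0 k)
      (fun τ _ => (hderiv (c (X (t k))) τ).continuousAt.continuousWithinAt)
      (fun τ _ => hderiv (c (X (t k))) τ)
    refine ⟨θ, hθ.1, hθ.2, ?_⟩
    rw [hθeq, hX0]
    refine div_nonpos_of_nonpos_of_nonneg ?_ (by linarith [ht0 k])
    have h1 := hmax (X (t k))
    have h2 := hmin x₀ (c (X (t k)))
    unfold fixedAction at h1 h2
    linarith
  choose θ hθ0 hθt hθ using hstep
  have hθlim : Filter.Tendsto θ Filter.atTop (𝓝 0) :=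
    squeeze_zero (fun k => (hθ0 k).le) (fun k => (hθt k).le) htlim
  -- No continuity of `c` is assumed: the minimizers stay bounded, and a limit of them minimizes at
  -- `x₀`, hence equals `c x₀` by uniqueness.
  obtain ⟨R, hR⟩ := exists_forall_norm_le hS (n := n) (fixedAction S n x₀ (x₀ + ρ) (c x₀))
    (‖x₀‖ + ‖u‖)
  obtain ⟨v, -, φ, hφ, hv⟩ := tendsto_subseq_of_bounded
    (Metric.isBounded_closedBall (x := (0 : Mid n d)) (r := R)) (x := fun k => c (X (t k)))
    (fun k => by
      rw [mem_closedBall_zero_iff]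
      refine hR _ _ _ ?_ (hmax _)
      calc ‖x₀ + t k • u‖ ≤ ‖x₀‖ + ‖t k • u‖ := norm_add_le _ _
        _ ≤ ‖x₀‖ + ‖u‖ := by
          rw [norm_smul, Real.norm_of_nonneg (ht0 k).le]
          have := mul_le_of_le_one_left (norm_nonneg u) (ht1 k)
          linarith)
  have hlim : ∀ τ : ℕ → ℝ, Filter.Tendsto τ Filter.atTop (𝓝 0) →
      Filter.Tendsto (fun k => X (τ (φ k))) Filter.atTop (𝓝 x₀) := by
    intro τ hτ
    have h := (hX.tendsto 0).comp (hτ.comp hφ.tendsto_atTop)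
    rwa [hX0] at h
  have hvmin : ∀ w, fixedAction S n x₀ (x₀ + ρ) v ≤ fixedAction S n x₀ (x₀ + ρ) w := by
    intro w
    have hX1 := hlim t htlim
    refine le_of_tendsto_of_tendsto'
      ((hF.continuous.tendsto (x₀, x₀ + ρ, v)).comp
        (hX1.prodMk_nhds ((hX1.add_const ρ).prodMk_nhds hv)))
      ((hF.continuous.tendsto (x₀, x₀ + ρ, w)).comp
        (hX1.prodMk_nhds ((hX1.add_const ρ).prodMk_nhds tendsto_const_nhds)))
      fun k => hmin _ w
  have hvc : v = c x₀ := eq_of_fderiv_fixedAction_eq_zero hΦ hS hc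
    (fderiv_fixedAction_eq_zero_of_forall_le hvmin)
    (fderiv_fixedAction_eq_zero_of_forall_le (hmin x₀))
  have hX2 := hlim θ hθlim
  have hD : Continuous fun g => fderiv ℝ (action S n) g (u, u, 0) :=
    (hF.continuous_fderiv (by norm_num)).clm_apply continuous_const
  rw [← hvc]
  exact le_of_tendsto' ((hD.tendsto (x₀, x₀ + ρ, v)).comp
    (hX2.prodMk_nhds ((hX2.add_const ρ).prodMk_nhds hv))) fun k => hθ (φ k)

/-- Where the minimal action `x ↦ min S(x, …, x + ρ)` is maximal, the minimizer closes up with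
equal initial and final momenta. -/
theorem momentum_closes_of_isMax (hΦ : IsGeneratedBy Φ S) (hS : IsGeneratingFunction S)
    (hc : HasNoConjugatePoints Φ) (ρ : E d) (c : E d → Mid n d)
    (hmin : ∀ x w, fixedAction S n x (x + ρ) (c x) ≤ fixedAction S n x (x + ρ) w) (x₀ : E d)
    (hmax : ∀ x, fixedAction S n x (x + ρ) (c x) ≤ fixedAction S n x₀ (x₀ + ρ) (c x₀)) :
    d₂ S (path n d n (x₀, x₀ + ρ, c x₀)) (x₀ + ρ) +
      d₁ S x₀ (path n d 1 (x₀, x₀ + ρ, c x₀)) = 0 := by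
  ext1 u
  have h0 : ∀ u : E d, fderiv ℝ (action S n) (x₀, x₀ + ρ, c x₀) (u, u, 0) =
      (d₂ S (path n d n (x₀, x₀ + ρ, c x₀)) (x₀ + ρ) +
        d₁ S x₀ (path n d 1 (x₀, x₀ + ρ, c x₀))) u := by
    intro u
    rw [fderiv_action_apply hS, Finset.sum_eq_zero, add_zero, add_apply, add_comm]
    intro j hj
    rw [path_succ (Finset.mem_range.1 hj) (u, u, 0)]
    simp
  have h1 := fderiv_action_diag_le_of_isMax hΦ hS hc ρ c hmin x₀ hmax u
  have h2 := fderiv_action_diag_le_of_isMax hΦ hS hc ρ c hmin x₀ hmax (-u)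
  rw [h0, map_neg] at h2
  rw [h0] at h1
  rw [zero_apply]
  linarith

/-- The minimal action from `x` to `x + r` attains its maximum over `x`. -/
theorem exists_max_fixedAction (hS : IsGeneratingFunction S) (r : Fin d → ℤ)
    (c : E d → Mid n d)
    (hmin : ∀ x w, fixedAction S n x (x + intVec r) (c x) ≤ fixedAction S n x (x + intVec r) w) :
    ∃ x₀, ∀ x, fixedAction S n x (x + intVec r) (c x) ≤
      fixedAction S n x₀ (x₀ + intVec r) (c x₀) := by
  obtain ⟨Q, hQ, hQne, hcov⟩ := exists_isCompact_forall_exists_add_intVec_mem d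
  -- Freezing the intermediate points at `c x` gives a continuous upper bound that is exact at `x`.
  have husc : UpperSemicontinuous fun x => fixedAction S n x (x + intVec r) (c x) := by
    intro x y hy
    have hcont : Continuous fun x' => fixedAction S n x' (x' + intVec r) (c x) :=
      (action_contDiff hS).continuous.comp (by fun_prop :
        Continuous fun x' => (x', x' + intVec r, c x))
    filter_upwards [hcont.continuousAt.eventually_lt continuousAt_const hy] with x' hx'
    exact (hmin x' (c x)).trans_lt hx'
  obtain ⟨x₀, -, hx₀⟩ := UpperSemicontinuousOn.exists_isMaxOn hQne hQ
    (husc.upperSemicontinuousOn Q)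
  refine ⟨x₀, fun x => ?_⟩
  obtain ⟨k, hk⟩ := hcov x
  refine le_trans ?_ (hx₀ hk)
  -- The minimizer for `x + intVec k`, translated back, competes at `x`; this one inequality of
  -- periodicity suffices.
  let s : ℕ → E d := fun i =>
    path n d i (x + intVec k, x + intVec k + intVec r, c (x + intVec k)) + intVec (-k)
  have hs0 : s 0 = x := by simp [s, intVec_neg]
  have hsn : s (n + 1) = x + intVec r := by simp [s, intVec_neg]; abel
  have h1 := action_mid (S := S) (n := n) s
  rw [hs0, hsn] at h1
  refine (hmin x (mid n s)).trans (h1.trans ?_).le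
  exact Finset.sum_congr rfl fun i _ => hS.periodic _ _ _

/-- An orbit segment from `x` to `x + r` with equal initial and final momenta has minimal action
among all sequences of the same length which close up to the translation `r`. -/
theorem fixedAction_le_of_momentum_closes (hΦ : IsGeneratedBy Φ S)
    (hS : IsGeneratingFunction S) (hc : HasNoConjugatePoints Φ) {r : Fin d → ℤ} {s s' : ℕ → E d}
    (hs : s (n + 1) = s 0 + intVec r) (hst : IsStationary S n s)
    (hcl : d₂ S (s n) (s (n + 1)) + d₁ S (s 0) (s 1) = 0)
    (hs' : s' (n + 1) = s' 0 + intVec r) :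
    ∑ i ∈ Finset.range (n + 1), S (s i, s (i + 1)) ≤
      ∑ i ∈ Finset.range (n + 1), S (s' i, s' (i + 1)) := by
  -- The cost of replacing the first and last steps of the repeated `s'` so that it shares the end
  -- points of the repeated `s`; it does not depend on the number of periods.
  set C : ℝ := S (s 0, s' 1) - S (s' 0, s' 1) + S (s' n, s 0 + intVec r) - S (s' n, s' (n + 1))
    with hC
  set a : ℝ := ∑ i ∈ Finset.range (n + 1), S (s i, s (i + 1)) with ha
  set b : ℝ := ∑ i ∈ Finset.range (n + 1), S (s' i, s' (i + 1)) with hb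
  have key : ∀ k : ℕ, 1 ≤ k → ((k + 1 : ℕ) : ℝ) * a ≤ ((k + 1 : ℕ) : ℝ) * b + C := by
    intro k hk
    -- At least two steps are needed for the modified first and last steps to be distinct; this is
    -- where `1 ≤ k` enters.
    obtain ⟨m, hm⟩ : ∃ m, (k + 1) * (n + 1) = m + 1 + 1 :=
      ⟨(k + 1) * (n + 1) - 2, by
        have : 2 * 1 ≤ (k + 1) * (n + 1) := Nat.mul_le_mul (by omega) (by omega)
        omega⟩
    let t : ℕ → E d := fun i => if i = 0 then periodicExt n r s 0 else
      if i = m + 2 then periodicExt n r s (m + 2) else periodicExt n r s' i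
    have ht0 : t 0 = periodicExt n r s 0 := rfl
    have htm : t (m + 2) = periodicExt n r s (m + 2) := by simp [t]
    have ht : ∀ i < m + 1, t (i + 1) = periodicExt n r s' (i + 1) := fun i hi => by
      simp [t, show i ≠ m + 1 by omega]
    have h1 := sum_le_sum_of_isStationary hΦ hS hc (n := m + 1) (t := t)
      (isStationary_periodicExt hS hs hst hcl (m + 1)) ht0 htm
    have h2 := sum_periodicExt hS hs (k + 1)
    have h3 := sum_periodicExt hS hs' (k + 1)
    rw [hm, ← ha] at h2
    rw [hm, ← hb, Finset.sum_range_succ, Finset.sum_range_succ'] at h3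
    rw [h2, Finset.sum_range_succ, Finset.sum_range_succ'] at h1
    have h4 : ∑ i ∈ Finset.range m, S (t (i + 1), t (i + 1 + 1)) =
        ∑ i ∈ Finset.range m,
          S (periodicExt n r s' (i + 1), periodicExt n r s' (i + 1 + 1)) := by
      refine Finset.sum_congr rfl fun i hi => ?_
      have := Finset.mem_range.1 hi
      rw [ht i (by omega), ht (i + 1) (by omega)]
    have hmod : (m + 1) % (n + 1) = n ∧ (m + 1) / (n + 1) = k := by
      have h5 : m + 1 = (n + 1) * k + n := by
        have : (k + 1) * (n + 1) = (n + 1) * k + (n + 1) := by ring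
        omega
      rw [h5, Nat.mul_add_mod, Nat.mul_add_div (by omega), Nat.div_eq_of_lt (by omega : n < n + 1),
        Nat.mod_eq_of_lt (by omega)]
      exact ⟨rfl, rfl⟩
    have h5 : S (t 0, t (0 + 1)) = S (s 0, s' 1) := by
      rw [ht0, ht 0 (by omega), periodicExt_zero, periodicExt_succ hs']
      simp
    have h6 : S (periodicExt n r s' 0, periodicExt n r s' (0 + 1)) = S (s' 0, s' 1) := by
      rw [apply_periodicExt hS hs']
      simp
    have h7 : S (periodicExt n r s' (m + 1), periodicExt n r s' (m + 1 + 1)) =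
        S (s' n, s' (n + 1)) := by
      rw [apply_periodicExt hS hs', hmod.1]
    have h8 : S (t (m + 1), t (m + 1 + 1)) = S (s' n, s 0 + intVec r) := by
      rw [ht m (by omega), htm, ← hm, periodicExt_mul, periodicExt, hmod.1, hmod.2, succ_nsmul',
        intVec_add, ← add_assoc, hS.periodic]
    rw [h4, h5, h8] at h1
    rw [h6, h7] at h3
    linarith
  -- If `b < a`, the gap `a - b` accumulates over the periods and eventually exceeds `C`.
  by_contra hlt
  rw [not_le] at hlt
  obtain ⟨k, hk⟩ := exists_nat_gt (C / (a - b))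
  rw [div_lt_iff₀ (by linarith)] at hk
  have h1 := key (k + 1) (by omega)
  push_cast at h1
  nlinarith

/-- Through every point of the configuration space passes exactly one orbit which is
periodic up to a prescribed integer translation. -/
theorem existsUnique_iterate_eq (hΦ : IsGeneratedBy Φ S) (hS : IsGeneratingFunction S)
    (hc : HasNoConjugatePoints Φ) (r : Fin d → ℤ) (x : E d) :
    ∃! p : StrongDual ℝ (E d), Φ^[n + 1] (x, p) = (x + intVec r, p) := by
  refine existsUnique_of_exists_of_unique ?_ fun p q hp hq =>
    orbit_fst_injective hΦ hS hc (n := n) x ?_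
  · choose c hmin using fun x => exists_forall_fixedAction_le hS (n := n) x (x + intVec r)
    obtain ⟨x₀, hx₀⟩ := exists_max_fixedAction hS r c hmin
    have hst : ∀ x, IsStationary S n fun i => path n d i (x, x + intVec r, c x) := fun x =>
      (fderiv_fixedAction_eq_zero_iff hS _ _ _).1
        (fderiv_fixedAction_eq_zero_of_forall_le (hmin x))
    have hcl₀ := momentum_closes_of_isMax hΦ hS hc (intVec r) c hmin x₀ hx₀
    have hle : fixedAction S n x₀ (x₀ + intVec r) (c x₀) ≤
        fixedAction S n x (x + intVec r) (c x) :=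
      fixedAction_le_of_momentum_closes hΦ hS hc (r := r)
        (s := fun i => path n d i (x₀, x₀ + intVec r, c x₀))
        (s' := fun i => path n d i (x, x + intVec r, c x)) (path_last _) (hst x₀)
        (by simpa using hcl₀) (path_last _)
    -- The maximum at `x₀` is also a minimum, so every `x` is a point of maximum.
    have hcl := momentum_closes_of_isMax hΦ hS hc (intVec r) c hmin x
      fun x' => (hx₀ x').trans hle
    have h := iterate_succ_of_isStationary hΦ (hst x)
    simp only [path_last, path_zero] at h
    rw [eq_neg_of_add_eq_zero_left hcl] at h
    exact ⟨_, h⟩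
  · exact (congrArg Prod.fst hp).trans (congrArg Prod.fst hq).symm

end Minimizers

/-! ### Passage between the torus and its universal cover. -/

section Lifts
variable {d : ℕ}

theorem proj_eq_proj_iff {z w : Cot d} :
    proj z = proj w ↔ ∃ r : Fin d → ℤ, z = w + (intVec r, 0) := by
  have key : ∀ a b : ℝ, (a : UnitAddCircle) = b ↔ ∃ m : ℤ, a = b + m := by
    intro a b
    rw [← sub_eq_zero, ← AddCircle.coe_sub, AddCircle.coe_eq_zero_iff]
    refine exists_congr fun m => ?_
    rw [zsmul_one, eq_comm, sub_eq_iff_eq_add']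
  constructor
  · intro h
    have h1 : ∀ i, ∃ m : ℤ, z.1 i = w.1 i + m := fun i =>
      (key _ _).1 (congrFun (congrArg Prod.fst h) i)
    choose r hr using h1
    have h2 : z.2 = w.2 :=
      (congrArg Prod.snd h : (proj z).2 = (proj w).2)
    refine ⟨r, Prod.ext ?_ (by simp [h2])⟩
    ext i
    simpa [intVec_apply] using hr i
  · rintro ⟨r, rfl⟩
    refine Prod.ext (funext fun i => (key _ _).2 ⟨r i, ?_⟩) (by simp [proj])
    simp [intVec_apply]

theorem intVec_eq_zero_of_norm_lt_one {r : Fin d → ℤ} (h : ‖intVec r‖ < 1) : r = 0 := by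
  funext i
  have h1 : ‖intVec r i‖ < 1 := (PiLp.norm_apply_le (intVec r) i).trans_lt h
  rw [intVec_apply, Real.norm_eq_abs, ← Int.cast_abs] at h1
  exact Int.abs_lt_one_iff.1 (by exact_mod_cast h1)

theorem eventually_eq_of_forall_intVec {X : Type*} [TopologicalSpace X] {f : X → E d} {x₀ : X}
    (hf : ContinuousAt f x₀) (hint : ∀ᶠ x in 𝓝 x₀, ∃ r : Fin d → ℤ, f x = intVec r) :
    ∀ᶠ x in 𝓝 x₀, f x = f x₀ := by
  obtain ⟨r₀, hr₀⟩ := hint.self_of_nhds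
  filter_upwards [hf (Metric.ball_mem_nhds _ one_pos), hint] with x hx ⟨r, hr⟩
  have h1 : ‖f x - f x₀‖ < 1 := mem_ball_iff_norm.1 hx
  have h2 : f x - f x₀ = intVec (r + -r₀) := by
    rw [intVec_add, intVec_neg, hr, hr₀, sub_eq_add_neg]
  rw [h2] at h1
  rw [← sub_eq_zero, h2, intVec_eq_zero_of_norm_lt_one h1, intVec_zero]

/-- Two lifts of the same map differ by a locally constant integer vector. -/
theorem eventually_eq_add_of_proj_eq {f g : Cot d → Cot d} {z : Cot d} (hf : ContinuousAt f z)
    (hg : ContinuousAt g z) (h : ∀ᶠ w in 𝓝 z, proj (f w) = proj (g w)) :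
    ∀ᶠ w in 𝓝 z, f w = g w + (f z - g z) := by
  have h1 : ∀ᶠ w in 𝓝 z, ∃ r : Fin d → ℤ, (f w).1 - (g w).1 = intVec r := by
    filter_upwards [h] with w hw
    obtain ⟨r, hr⟩ := proj_eq_proj_iff.1 hw
    exact ⟨r, by simp [hr]⟩
  have h2 := eventually_eq_of_forall_intVec (f := fun w => (f w).1 - (g w).1)
    ((continuous_fst.continuousAt.comp hf).sub (continuous_fst.continuousAt.comp hg)) h1
  have h3 : ∀ w, proj (f w) = proj (g w) → (f w).2 = (g w).2 := fun w hw =>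
    (congrArg Prod.snd hw : (proj (f w)).2 = (proj (g w)).2)
  filter_upwards [h, h2] with w hw hw2
  refine Prod.ext ?_ ?_
  · rw [Prod.fst_add, Prod.fst_sub, ← hw2]
    abel
  · rw [Prod.snd_add, Prod.snd_sub, h3 w hw, h3 z h.self_of_nhds]
    abel

/-- Translating the second variable of a generating function by an integer vector. -/
theorem IsGeneratingFunction.comp_sub_intVec {S : E d × E d → ℝ} (hS : IsGeneratingFunction S)
    (k : Fin d → ℤ) : IsGeneratingFunction fun z => S (z + (0, -intVec k)) where
  contDiff := hS.contDiff.comp (contDiff_id.add contDiff_const)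
  periodic r x y := by
    have h := hS.periodic r x (y + -intVec k)
    simp only [Prod.mk_add_mk, add_zero]
    rwa [add_right_comm] at h
  twist := by
    obtain ⟨A, hA0, hA⟩ := hS.twist
    refine ⟨A, hA0, fun x y ξ => ?_⟩
    have h1 : fderiv ℝ (fun z => S (z + (0, -intVec k))) =
        fun z => fderiv ℝ S (z + (0, -intVec k)) :=
      funext fun z => fderiv_comp_add_right (𝕜 := ℝ) (f := S) (0, -intVec k)
    rw [h1, fderiv_comp_add_right (𝕜 := ℝ) (f := fderiv ℝ S) (0, -intVec k)]
    exact hA _ _ ξ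

theorem IsGeneratedBy.add_intVec {S : E d × E d → ℝ} {Φ Ψ : Cot d → Cot d}
    (hΦ : IsGeneratedBy Φ S) (k : Fin d → ℤ) (hΨ : ∀ z, Ψ z = Φ z + (intVec k, 0)) :
    IsGeneratedBy Ψ fun z => S (z + (0, -intVec k)) := by
  intro x p x' p'
  have h1 : d₁ (fun z => S (z + (0, -intVec k))) x x' = d₁ S x (x' + -intVec k) := by
    simp [d₁]
  have h2 : d₂ (fun z => S (z + (0, -intVec k))) x x' = d₂ S x (x' + -intVec k) := by
    have h := fderiv_comp_add_right (𝕜 := ℝ) (f := fun u => S (x, u)) (x := x') (-intVec k)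
    simpa [d₂] using h
  rw [h1, h2, ← hΦ, hΨ, ← eq_sub_iff_add_eq]
  simp [sub_eq_add_neg]

theorem IsLift.iterate {Fbar : Cot d → Cot d} {F : CotTorus d → CotTorus d}
    (h : IsLift Fbar F) (N : ℕ) (z : Cot d) : proj (Fbar^[N] z) = F^[N] (proj z) :=
  (Function.Semiconj.iterate_right (f := proj) (fun z => h.semiconj z) N) z

/-- Every continuous lift of a twist map is generated by a generating function. -/
theorem exists_isGeneratedBy_of_isLift {F : Equiv.Perm (CotTorus d)} (hF : IsTwistMap F)
    {Fbar : Cot d → Cot d} (hFbar : IsLift Fbar F) :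
    ∃ S, IsGeneratingFunction S ∧ IsGeneratedBy Fbar S := by
  obtain ⟨S, hS, Φ, hΦ, hproj⟩ := hF
  have hΦcont : Continuous Φ := by
    have h1 := hΦ.continuous_fst hS
    have h2 : Continuous fun z => (Φ z).2 := by
      simp only [hΦ.apply_snd_eq]
      exact hS.continuous_d₂.comp (continuous_fst.prodMk h1)
    exact h1.prodMk h2
  have hpp : ∀ z, proj (Fbar z) = proj (Φ z) := fun z => by rw [hFbar.semiconj, hproj]
  -- Two continuous lifts differ by a locally constant integer vector, which is constant because
  -- `T*ℝ^d` is connected; it is absorbed into the second variable of `S`.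
  have hloc : IsLocallyConstant fun z => Fbar z - Φ z := by
    rw [IsLocallyConstant.iff_eventually_eq]
    intro z
    filter_upwards [eventually_eq_add_of_proj_eq hFbar.continuous.continuousAt
      hΦcont.continuousAt (Filter.Eventually.of_forall hpp)] with w hw
    rw [hw, add_sub_cancel_left]
  obtain ⟨k, hk⟩ := proj_eq_proj_iff.1 (hpp 0)
  refine ⟨_, hS.comp_sub_intVec k, hΦ.add_intVec k fun z => ?_⟩
  have h := hloc.apply_eq_of_preconnectedSpace z 0
  rw [hk, add_sub_cancel_left] at h
  rw [← h, add_sub_cancel]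

/-- The local lift that defines the differential on the torus agrees near the point with the iterate
of `Fbar` up to a constant, so both have the same derivative. Differentiability of `Fbar` itself is
the case `N = 1`. -/
theorem hasNoConjugatePoints_of_isLift {F : Equiv.Perm (CotTorus d)}
    (hconj : WithoutConjugatePoints F) {Fbar : Cot d → Cot d} (hFbar : IsLift Fbar F) :
    HasNoConjugatePoints Fbar := by
  have key : ∀ (z : Cot d) (N : ℕ), 1 ≤ N → ∃ L : Cot d →L[ℝ] Cot d,
      HasFDerivAt Fbar^[N] L z ∧ vertical d ⊓ (vertical d).map L.toLinearMap = ⊥ := by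
    intro z N hN
    obtain ⟨L, ⟨g, hg, hgL⟩, hL⟩ := hconj z N (by omega)
    refine ⟨L, ?_, hL⟩
    have h1 : ∀ᶠ w in 𝓝 z, proj (Fbar^[N] w) = proj (g w) := by
      filter_upwards [hg] with w hw
      rw [hw, hFbar.iterate, zpow_natCast, Equiv.Perm.iterate_eq_pow]
    exact (hgL.add_const _).congr_of_eventuallyEq
      (eventually_eq_add_of_proj_eq (hFbar.continuous.iterate N).continuousAt
        hgL.continuousAt h1)
  refine ⟨fun z => ?_, fun N hN z η h => ?_⟩
  · obtain ⟨L, hL, -⟩ := key z 1 le_rfl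
    exact hL.differentiableAt
  · obtain ⟨L, hL, hLV⟩ := key z N hN
    rw [hL.fderiv] at h ⊢
    have hmem : L (0, η) ∈ vertical d ⊓ (vertical d).map L.toLinearMap :=
      ⟨h, (0, η), rfl, rfl⟩
    rw [hLV] at hmem
    exact (Submodule.mem_bot ℝ).1 hmem

end Lifts
end TwistMap

end

theorem theorem1 (d : ℕ) (hd : 1 ≤ d)
    (F : Equiv.Perm (TwistMap.CotTorus d)) (hF : TwistMap.IsTwistMap F)
    (hconj : TwistMap.WithoutConjugatePoints F)
    (Fbar : TwistMap.Cot d → TwistMap.Cot d) (hFbar : TwistMap.IsLift Fbar F) :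
    (∀ N : ℕ, 1 ≤ N → ∀ (r : Fin d → ℤ) (x : TwistMap.E d),
      ∃! p : StrongDual ℝ (TwistMap.E d), Fbar^[N] (x, p) = (x + TwistMap.intVec r, p)) ∧
    (∀ N : ℕ, 1 ≤ N → ∀ (x : TwistMap.E d) (p : StrongDual ℝ (TwistMap.E d)),
      F^[N] (TwistMap.proj (x, p)) = TwistMap.proj (x, p) ↔
        ∃! r : Fin d → ℤ, Fbar^[N] (x, p) = (x + TwistMap.intVec r, p)) := by
  constructor
  · intro N hN r x
    obtain ⟨S, hS, hgen⟩ := TwistMap.exists_isGeneratedBy_of_isLift hF hFbar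
    obtain ⟨n, rfl⟩ : ∃ n, N = n + 1 := ⟨N - 1, by omega⟩
    exact TwistMap.existsUnique_iterate_eq hgen hS
      (TwistMap.hasNoConjugatePoints_of_isLift hconj hFbar) r x
  · intro N _ x p
    rw [← hFbar.iterate, TwistMap.proj_eq_proj_iff]
    simp only [Prod.mk_add_mk, add_zero]
    refine ⟨fun ⟨r, hr⟩ => ⟨r, hr, fun r' hr' => ?_⟩, ExistsUnique.exists⟩
    have h := congrArg Prod.fst (hr'.symm.trans hr)
    exact TwistMap.intVec_injective (add_left_cancel h)
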